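/- Let $d\ge 3$ and $\delta\in(0,1)$. Let $G(0)$ be the expected number of visits to $0$ (time $0$ included) of simple random walk on $\mathbb{Z}^d$ started from $0$. For each $n\ge 0$ let $\phi=(\phi_x)$ be the discrete Gaussian free field on $[0,n]^d\cap\mathbb{Z}^d$ with zero boundary condition on $\partial[0,n]^d$, that is, a centred Gaussian process indexed by $[0,n]^d\cap\mathbb{Z}^d$ with $$\operatorname{Cov}(\phi_x,\phi_y)=\mathbb{E}_x\Big[\sum_{0\le i<\tau}\mathbf{1}(X_i=y)\Big],$$ where $X$ is simple random walk started from $x$ and $\tau$ is the first time $i\ge 0$ at which $X_i\in\partial[0,n]^d\cap\mathbb{Z}^d$, the set of points of $[0,n]^d\cap\mathbb{Z}^d$ with some coordinate equal to $0$ or $n$. For $\alpha>0$ let $$\mathcal{H}_\alpha=\Big\{x\in[\delta n,(1-\delta)n]^d\cap\mathbb{Z}^d:\ \phi_x\ge\sqrt{2\alpha d\,G(0)\log n}\Big\},$$ and let $\widetilde\nu_{\alpha,n}$ be the law of the random set $\{x\in[\delta n,(1-\delta)n]^d\cap\mathbb{Z}^d:\widetilde Z_x=1\}$, where the $\widetilde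 Z_x$ are independent Bernoulli random variables with $\mathbb{P}(\widetilde Z_x=1)=\mathbb{P}\big(\phi_x\ge\sqrt{2\alpha d\,G(0)\log n}\big)$. If $$\alpha>\frac34\cdot\frac{d-\frac23}{d-1},$$ then $$\big\|\mathcal{L}(\mathcal{H}_\alpha)-\widetilde\nu_{\alpha,n}\big\|_{\mathrm{TV}}\longrightarrow 0\qquad\text{as } n\to\infty,$$ where $\|\mu-\nu\|_{\mathrm{TV}}=\sup_A|\mu(A)-\nu(A)|$, the supremum being over all events $A$. -/

import Mathlib

open MeasureTheory ProbabilityTheory Filter Topology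
open scoped ENNReal unitInterval

namespace GFF

noncomputable section

/-- The lattice step encoded by `(i, b)`: `+eᵢ` if `b` is true and `-eᵢ` otherwise. -/
def step {d : ℕ} (s : Fin d × Bool) : Fin d → ℤ :=
  Pi.single s.1 (if s.2 then 1 else -1)

/-- The law of the increments of simple random walk on `ℤ^d`: an i.i.d. sequence of uniformly
chosen elements of `{±e₁, …, ±e_d}`. -/
def stepLaw (d : ℕ) : Measure (ℕ → Fin d × Bool) :=
  Measure.infinitePi fun _ : ℕ => uniformOn (Set.univ : Set (Fin d × Bool))

/-- Simple random walk on `ℤ^d` started from `x`, at time `k`, as a function of its increments. -/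
def walk {d : ℕ} (x : Fin d → ℤ) (k : ℕ) (s : ℕ → Fin d × Bool) : Fin d → ℤ :=
  x + ∑ j ∈ Finset.range k, step (s j)

/-- `G(0) = G(0,0)`: the expected number of visits to `0` of simple random walk on `ℤ^d` started
from `0` (which is finite for `d ≥ 3`). -/
def greenZero (d : ℕ) : ℝ :=
  (∫⁻ s, ∑' k : ℕ, Set.indicator {s | walk (0 : Fin d → ℤ) k s = 0} (fun _ => (1 : ℝ≥0∞)) s
    ∂(stepLaw d)).toReal

/-- The box `[0,n]^d ∩ ℤ^d`. -/
abbrev box (d n : ℕ) : Finset (Fin d → ℤ) :=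
  Finset.Icc (fun _ => 0) (fun _ => (n : ℤ))

/-- The lattice points of the boundary of the cube `[0,n]^d`. -/
def boxBoundary (d n : ℕ) : Set (Fin d → ℤ) :=
  {x | x ∈ box d n ∧ ∃ i, x i = 0 ∨ x i = (n : ℤ)}

/-- The first time (possibly infinite) that the walk from `x` is in the boundary of `[0,n]^d`. -/
def exitTime {d : ℕ} (n : ℕ) (x : Fin d → ℤ) : (ℕ → Fin d × Bool) → WithTop ℕ :=
  hittingAfter (walk x) (boxBoundary d n) 0

/-- The Green's function of `[0,n]^d ∩ ℤ^d` with zero boundary condition: the expected number of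
visits to `y`, strictly before hitting the boundary, of simple random walk started from `x`.
It vanishes if `x` or `y` is in the boundary. -/
def boxGreen {d : ℕ} (n : ℕ) (x y : Fin d → ℤ) : ℝ :=
  (∫⁻ s, ∑' k : ℕ, Set.indicator {s | (k : WithTop ℕ) < exitTime n x s ∧ walk x k s = y}
    (fun _ => (1 : ℝ≥0∞)) s ∂(stepLaw d)).toReal

/-- `φ` is a discrete Gaussian free field on `[0,n]^d ∩ ℤ^d` with zero boundary condition. -/
structure IsDGFF (d n : ℕ) {Ω : Type*} [MeasurableSpace Ω] (φ : box d n → Ω → ℝ)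
    (P : Measure Ω) : Prop where
  isGaussianProcess : IsGaussianProcess φ P
  mean_zero : ∀ x, ∫ ω, φ x ω ∂P = 0
  cov_eq : ∀ x y : box d n, cov[φ x, φ y; P] = boxGreen n (x : Fin d → ℤ) (y : Fin d → ℤ)

open Classical in
/-- The points of `[δn,(1-δ)n]^d ∩ ℤ^d` (for `0 < δ < 1` this set is contained in the box). -/
def bulk (d n : ℕ) (δ : ℝ) : Finset (box d n) :=
  Finset.univ.filter fun x =>
    ∀ i, δ * n ≤ ((x : Fin d → ℤ) i : ℝ) ∧ ((x : Fin d → ℤ) i : ℝ) ≤ (1 - δ) * n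

/-- The level `√(2 α d G(0) log n)`. -/
def level (d n : ℕ) (α : ℝ) : ℝ :=
  Real.sqrt (2 * α * d * greenZero d * Real.log n)

/-- The set of `α`-high points of `φ`, as a random subset of `[δn,(1-δ)n]^d ∩ ℤ^d`. -/
def highPoints {d n : ℕ} (δ α : ℝ) {Ω : Type*} (φ : box d n → Ω → ℝ) (ω : Ω) :
    Set (bulk d n δ) :=
  {x | level d n α ≤ φ x ω}

/-- The probability that the given point is an `α`-high point of `φ`. -/
def highProb {d n : ℕ} (δ α : ℝ) {Ω : Type*} [MeasurableSpace Ω] (φ : box d n → Ω → ℝ)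
    (P : Measure Ω) [IsProbabilityMeasure P] (x : bulk d n δ) : I :=
  ⟨P.real {ω | level d n α ≤ φ x ω}, measureReal_nonneg, measureReal_le_one⟩

/-- The law of the random set `{i | Zᵢ = 1}`, where the `Zᵢ` are independent Bernoulli random
variables with success probabilities `p i`. -/
def bernoulliSetLaw {ι : Type*} [Fintype ι] (p : ι → I) : Measure (Set ι) :=
  (Measure.pi fun i => bernoulliMeasure true false (p i)).map fun Z => {i | Z i = true}

/-- The total variation distance `sup_A |μ(A) - ν(A)|` over all measurable events `A`. -/
def tvDist {E : Type*} [MeasurableSpace E] (μ ν : Measure E) : ℝ :=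
  ⨆ A : {A : Set E // MeasurableSet A}, |μ.real A - ν.real A|

end

end GFF

/-!
The exceedances `φ x ≥ level` form a positively associated family of rare events, and such a family
is close to an independent one as soon as the sum of its pairwise covariances is small.

Comparison with the product law. The coordinates of the random configuration are replaced by
independent ones one at a time (`abs_integral_sub_integral_pi_le`); the error of a replacement is
the covariance of one exceedance with a bounded function of the others. Regressing a Gaussian vector
on one coordinate leaves residuals independent of it, with nonnegative coefficients as the field is
nonnegatively correlated. Writing the covariance with two independent copies of that coordinate
and common residuals, the other exceedances can only be created when the coordinate is raised, so
a union bound gives at most twice the sum of the pairwise covariances (`abs_coordCov_le`).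
Hence the total variation distance is at most `2 ∑ Cov(x, y)` over ordered pairs of distinct points
(`tvDist_le`).

Pairs of points. Let `g(x, y)` be the Green's function of the box and `G` the one of `ℤ^d`. If
`g(x, y) < η`, then the covariance of the exceedances is, up to a negligible term, at most
`g(x, y) n ^ (-2αd + 4ηαd)` times a power of `log n` (`pairCov_le_of_regCoeff_le`). The sum of
`g(x, y)` over `y` is the expected exit time, at most `d n ^ 2` (`sum_boxGreen_le`), so these pairs
contribute `n ^ (d + 2 - 2αd + o(1))`, which tends to zero by the assumption on `α` (`add_two_lt`).
The other pairs are at a bounded distance (`exists_card_le_of_latticeGreen_ge`) and contribute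
`n ^ (d - 2αd G(0) / (G(0) + G(x, y)))` by a Chernoff bound for `φ x + φ y`; this exponent is
negative if `G(x, y)` is not too close to `G(0)` (`greenZero_add_pairGreen_lt`).

Random walk. By Fourier inversion the sum of two consecutive transition probabilities is maximal at
the origin, which gives `G(z) ≤ G(0) - 1 + 1 / (2d)` for `z ≠ 0` and uniform tails. It remains to
bound `G(0)`, the mean of `1 / (1 - u)` with `u = (∑ cos (2πxᵢ)) / d`. The Laplace transform of
`1 - cos (2πx)` at `s` is at most `(1 + 2s) ^ (-1/2)`, whence
`G(0) ≤ ∫ (1 + 2t/d) ^ (-d/2) dt = d / (d - 2)` (`sum_heatKernel_zero_le`).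
-/

namespace GFF

/-! ### Total variation distance to a product of Bernoulli laws -/

section Resampling

variable {ι : Type*} [Fintype ι] [DecidableEq ι]

/-- The covariance of the indicator of `{b k = true}` with `D` under the law `m`. -/
noncomputable def coordCov (m : Measure (ι → Bool)) (k : ι) (D : (ι → Bool) → ℝ) : ℝ :=
  ∫ b, (if b k = true then D b else 0) ∂m - m.real {b | b k = true} * ∫ b, D b ∂m

/-- Averaging out the `k`-th coordinate, resampled to be `true` with probability `p`. -/
def resample (p : ℝ) (k : ι) (f : (ι → Bool) → ℝ) (b : ι → Bool) : ℝ :=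
  p * f (Function.update b k true) + (1 - p) * f (Function.update b k false)

/-- The effect on `f` of switching the `k`-th coordinate on. -/
def pivot (k : ι) (f : (ι → Bool) → ℝ) (b : ι → Bool) : ℝ :=
  f (Function.update b k true) - f (Function.update b k false)

omit [Fintype ι] in
lemma dependsOn_pivot (k : ι) (f : (ι → Bool) → ℝ) : DependsOn (pivot k f) {k}ᶜ := by
  intro x y h
  have key : ∀ e, Function.update x k e = Function.update y k e := by
    intro e
    ext i
    by_cases hi : i = k
    · subst hi; simp
    · simp [Function.update_of_ne hi, h i (by simpa using hi)]
  simp [pivot, key]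

omit [Fintype ι] in
lemma dependsOn_resample (p : ℝ) (k : ι) {f : (ι → Bool) → ℝ} {T : Set ι}
    (hf : DependsOn f (insert k T)) : DependsOn (resample p k f) T := by
  intro x y h
  have key : ∀ e, f (Function.update x k e) = f (Function.update y k e) := by
    intro e
    apply hf
    intro i hi
    by_cases hk : i = k
    · subst hk; simp
    · simp [Function.update_of_ne hk, h i (by simpa [hk] using hi)]
  simp [resample, key]

lemma integral_sub_integral_resample (m : Measure (ι → Bool)) [IsProbabilityMeasure m] (k : ι)
    (f : (ι → Bool) → ℝ) :
    ∫ b, f b ∂m - ∫ b, resample (m.real {b | b k = true}) k f b ∂m = coordCov m k (pivot k f) := by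
  have hI : ∀ g : (ι → Bool) → ℝ, Integrable g m := fun g => Integrable.of_finite
  have h1 : ∀ b, f b = f (Function.update b k false) + (if b k = true then pivot k f b else 0) := by
    intro b
    cases hb : b k
    · simp [← hb]
    · have : Function.update b k true = b := by rw [← hb]; simp
      simp [pivot, this]
  have h2 : ∀ b, resample (m.real {b | b k = true}) k f b
      = f (Function.update b k false) + m.real {b | b k = true} * pivot k f b := by
    intro b; simp only [resample, pivot]; ring
  rw [integral_congr_ae (ae_of_all _ h1), integral_congr_ae (ae_of_all _ h2),
    integral_add (hI _) (hI _), integral_add (hI _) (hI _), integral_const_mul, coordCov]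
  ring

lemma coordCov_pi_eq_zero (q : ι → I) (k : ι) {D : (ι → Bool) → ℝ} (hD : DependsOn D {k}ᶜ) :
    coordCov (Measure.pi fun i => bernoulliMeasure true false (q i)) k D = 0 := by
  set ν := Measure.pi fun i => bernoulliMeasure true false (q i)
  have hind : iIndepFun (fun i (b : ι → Bool) => b i) ν :=
    iIndepFun_pi (X := fun _ b => b) (fun i => aemeasurable_id)
  have h2 := hind.indepFun_finset {k} {k}ᶜ (by simp) (fun i => by fun_prop)
  let D' : (({k}ᶜ : Finset ι) → Bool) → ℝ := fun g => D fun i => if h : i ∈ ({k}ᶜ : Finset ι) then g ⟨i, h⟩ else false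
  let a : (({k} : Finset ι) → Bool) → ℝ := fun g => if g ⟨k, by simp⟩ = true then 1 else 0
  have h3 := h2.comp (φ := a) (ψ := D') (measurable_of_finite _) (measurable_of_finite _)
  have h4 := h3.integral_mul_eq_mul_integral Integrable.of_finite.aestronglyMeasurable Integrable.of_finite.aestronglyMeasurable
  have hD' : ∀ b : ι → Bool, D' (fun i => b i) = D b := by
    intro b
    apply hD
    intro i hi
    have : i ≠ k := by simpa using hi
    simp [this]
  have e1 : ∀ b : ι → Bool, (if b k = true then D b else 0)
      = ((a ∘ fun (b : ι → Bool) (i : ({k} : Finset ι)) => b i) * (D' ∘ fun (b : ι → Bool) (i : ({k}ᶜ : Finset ι)) => b i)) b := by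
    intro b
    simp [a, hD' b]
  have e2 : ∫ b, (a ∘ fun (b : ι → Bool) (i : ({k} : Finset ι)) => b i) b ∂ν = ν.real {b | b k = true} := by
    rw [← integral_indicator_one (Set.toFinite _).measurableSet]
    congr 1
    ext b
    simp [a, Set.indicator_apply]
  rw [coordCov, integral_congr_ae (ae_of_all _ e1), h4, e2]
  simp [hD']

/-- A law on configurations is close to the product law with the same marginals if each coordinate
is almost uncorrelated with every function of the other coordinates: the coordinates are replaced
by independent ones one at a time. -/
theorem abs_integral_sub_integral_pi_le (m : Measure (ι → Bool)) [IsProbabilityMeasure m]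
    (q : ι → I) (hq : ∀ k, (q k : ℝ) = m.real {b | b k = true}) (c : ι → ℝ)
    (hc : ∀ k (D : (ι → Bool) → ℝ), DependsOn D {k}ᶜ → (∀ b, |D b| ≤ 1) → |coordCov m k D| ≤ c k)
    (f : (ι → Bool) → ℝ) (hf : ∀ b, f b ∈ Set.Icc (0 : ℝ) 1) :
    |∫ b, f b ∂m - ∫ b, f b ∂(Measure.pi fun i => bernoulliMeasure true false (q i))|
      ≤ ∑ k, c k := by
  set ν := Measure.pi fun i => bernoulliMeasure true false (q i) with hν
  have hνk : ∀ k, ν.real {b | b k = true} = q k := by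
    intro k
    have : {b : ι → Bool | b k = true} = (fun b => b k) ⁻¹' ({true} : Set Bool) := by ext; simp
    rw [this, measureReal_def, ← Measure.map_apply (measurable_pi_apply k) (by simp),
      show Measure.map (fun b : ι → Bool => b k) ν = _ from (measurePreserving_eval _ k).map_eq,
      ← measureReal_def]
    simp
  suffices H : ∀ T : Finset ι, ∀ f : (ι → Bool) → ℝ, (∀ b, f b ∈ Set.Icc (0 : ℝ) 1) →
      DependsOn f (T : Set ι) → |∫ b, f b ∂m - ∫ b, f b ∂ν| ≤ ∑ k ∈ T, c k from
    H Finset.univ f hf (by simpa using dependsOn_univ f)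
  intro T
  induction T using Finset.induction_on with
  | empty =>
    intro f _ hd
    have : f = fun _ => f (fun _ => false) := by
      ext b; exact DependsOn.empty (by simpa using hd) _ _
    rw [this]; simp
  | insert k T hk ih =>
    intro f hf hd
    have hp : m.real {b | b k = true} ∈ Set.Icc (0 : ℝ) 1 := ⟨measureReal_nonneg, measureReal_le_one⟩
    have hA : ∀ b, resample (m.real {b | b k = true}) k f b ∈ Set.Icc (0 : ℝ) 1 := by
      intro b
      have h1 := hf (Function.update b k true)
      have h2 := hf (Function.update b k false)
      simp only [Set.mem_Icc, resample] at *
      constructor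
      · have := mul_nonneg hp.1 h1.1
        have := mul_nonneg (sub_nonneg.2 hp.2) h2.1
        linarith
      · have := mul_le_mul_of_nonneg_left h1.2 hp.1
        have := mul_le_mul_of_nonneg_left h2.2 (sub_nonneg.2 hp.2)
        linarith
    have h1 := integral_sub_integral_resample m k f
    have h2 := integral_sub_integral_resample ν k f
    rw [coordCov_pi_eq_zero q k (dependsOn_pivot k f), hνk, hq] at h2
    have h3 := ih _ hA (dependsOn_resample _ k (by simpa using hd))
    have h4 := hc k (pivot k f) (dependsOn_pivot k f) (by
      intro b
      have h1 := hf (Function.update b k true)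
      have h2 := hf (Function.update b k false)
      simp only [Set.mem_Icc, pivot, abs_le] at *
      constructor <;> linarith)
    rw [← h1] at h4
    rw [Finset.sum_insert hk]
    have : ∫ b, f b ∂m - ∫ b, f b ∂ν
      = (∫ b, f b ∂m - ∫ b, resample (m.real {b | b k = true}) k f b ∂m)
        + (∫ b, resample (m.real {b | b k = true}) k f b ∂m
          - ∫ b, resample (m.real {b | b k = true}) k f b ∂ν) := by linarith
    rw [this]
    exact (abs_add_le _ _).trans (add_le_add h4 h3)

end Resampling

section Symmetrization

/-- Twice a covariance is the expected product of the increments between two independent copies of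
the first variable. -/
lemma integral_symmetrize {W : Type*} [MeasurableSpace W] (μ : Measure ℝ) [IsProbabilityMeasure μ]
    (κ : Measure W) [IsProbabilityMeasure κ] (a : ℝ → ℝ) (F : ℝ × W → ℝ) (ha : Measurable a)
    (hF : Measurable F) (ha1 : ∀ s, |a s| ≤ 1) (hF1 : ∀ s, |F s| ≤ 1) :
    ∫ z : (ℝ × ℝ) × W, (a z.1.1 - a z.1.2) * (F (z.1.1, z.2) - F (z.1.2, z.2)) ∂((μ.prod μ).prod κ)
      = 2 * (∫ z : ℝ × W, a z.1 * F z ∂(μ.prod κ) - (∫ s, a s ∂μ) * ∫ z, F z ∂(μ.prod κ)) := by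
  have hab : ∀ x y : ℝ, |x| ≤ 1 → |y| ≤ 1 → ‖x * y‖ ≤ 1 := by
    intro x y hx hy
    rw [norm_mul]; exact mul_le_one₀ hx (abs_nonneg _) hy
  have I1 : ∀ (g h : (ℝ × ℝ) × W → ℝ), Measurable g → Measurable h → (∀ z, |g z| ≤ 1) →
      (∀ z, |h z| ≤ 1) → Integrable (fun z => g z * h z) ((μ.prod μ).prod κ) := by
    intro g h hg hh hg1 hh1
    exact Integrable.of_bound (hg.mul hh).aestronglyMeasurable 1
      (ae_of_all _ fun z => hab _ _ (hg1 z) (hh1 z))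
  have J11 := I1 (fun z => a z.1.1) (fun z => F (z.1.1, z.2)) (by fun_prop) (by fun_prop)
    (fun _ => ha1 _) (fun _ => hF1 _)
  have J12 := I1 (fun z => a z.1.1) (fun z => F (z.1.2, z.2)) (by fun_prop) (by fun_prop)
    (fun _ => ha1 _) (fun _ => hF1 _)
  have J21 := I1 (fun z => a z.1.2) (fun z => F (z.1.1, z.2)) (by fun_prop) (by fun_prop)
    (fun _ => ha1 _) (fun _ => hF1 _)
  have J22 := I1 (fun z => a z.1.2) (fun z => F (z.1.2, z.2)) (by fun_prop) (by fun_prop)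
    (fun _ => ha1 _) (fun _ => hF1 _)
  have mp1 : MeasurePreserving (fun z : (ℝ × ℝ) × W => (z.1.1, z.2)) ((μ.prod μ).prod κ) (μ.prod κ) :=
    MeasurePreserving.prod (measurePreserving_fst) (MeasurePreserving.id κ)
  have mp2 : MeasurePreserving (fun z : (ℝ × ℝ) × W => (z.1.2, z.2)) ((μ.prod μ).prod κ) (μ.prod κ) :=
    MeasurePreserving.prod (measurePreserving_snd) (MeasurePreserving.id κ)
  have cv : ∀ {G : ℝ × W → ℝ} {T : (ℝ × ℝ) × W → ℝ × W}, Measurable G →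
      MeasurePreserving T ((μ.prod μ).prod κ) (μ.prod κ) →
      ∫ z, G (T z) ∂((μ.prod μ).prod κ) = ∫ z, G z ∂(μ.prod κ) := by
    intro G T hG hT
    rw [← hT.map_eq, integral_map hT.measurable.aemeasurable hG.aestronglyMeasurable]
  have E11 : ∫ z : (ℝ × ℝ) × W, a z.1.1 * F (z.1.1, z.2) ∂((μ.prod μ).prod κ)
      = ∫ z : ℝ × W, a z.1 * F z ∂(μ.prod κ) := cv (G := fun z => a z.1 * F z) (by fun_prop) mp1
  have E22 : ∫ z : (ℝ × ℝ) × W, a z.1.2 * F (z.1.2, z.2) ∂((μ.prod μ).prod κ)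
      = ∫ z : ℝ × W, a z.1 * F z ∂(μ.prod κ) := cv (G := fun z => a z.1 * F z) (by fun_prop) mp2
  have mpa : MeasurePreserving (fun z : (ℝ × ℝ) × W => (z.1.1, (z.1.2, z.2))) ((μ.prod μ).prod κ)
      (μ.prod (μ.prod κ)) := measurePreserving_prodAssoc μ μ κ
  have mpb : MeasurePreserving (fun z : (ℝ × ℝ) × W => (z.1.2, (z.1.1, z.2))) ((μ.prod μ).prod κ)
      (μ.prod (μ.prod κ)) :=
    mpa.comp (MeasurePreserving.prod (Measure.measurePreserving_swap) (MeasurePreserving.id κ))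
  have E12 : ∫ z : (ℝ × ℝ) × W, a z.1.1 * F (z.1.2, z.2) ∂((μ.prod μ).prod κ)
      = (∫ s, a s ∂μ) * ∫ z, F z ∂(μ.prod κ) := by
    rw [← integral_prod_mul, ← mpa.map_eq, integral_map mpa.measurable.aemeasurable]
    exact (Measurable.aestronglyMeasurable (by fun_prop))
  have E21 : ∫ z : (ℝ × ℝ) × W, a z.1.2 * F (z.1.1, z.2) ∂((μ.prod μ).prod κ)
      = (∫ s, a s ∂μ) * ∫ z, F z ∂(μ.prod κ) := by
    rw [← integral_prod_mul, ← mpb.map_eq, integral_map mpb.measurable.aemeasurable]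
    exact (Measurable.aestronglyMeasurable (by fun_prop))
  have : ∀ z : (ℝ × ℝ) × W, (a z.1.1 - a z.1.2) * (F (z.1.1, z.2) - F (z.1.2, z.2))
      = (a z.1.1 * F (z.1.1, z.2) - a z.1.1 * F (z.1.2, z.2))
        - (a z.1.2 * F (z.1.1, z.2) - a z.1.2 * F (z.1.2, z.2)) := by intro z; ring
  have J1 := J11.sub J12
  have J2 := J21.sub J22
  simp only [Pi.sub_def] at J1 J2
  rw [integral_congr_ae (ae_of_all _ this), integral_sub J1 J2,
    integral_sub J11 J12, integral_sub J21 J22, E11, E12, E21, E22]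
  ring

end Symmetrization

/-! ### Association of the exceedances of a Gaussian vector -/

section Association

variable {ι : Type*} [Fintype ι] {Ω : Type*} [MeasurableSpace Ω] {P : Measure Ω}
  {φ : ι → Ω → ℝ}

/-- The coefficient of the linear regression of `Y` on `X`. -/
noncomputable def regCoeff (P : Measure Ω) (Y X : Ω → ℝ) : ℝ := cov[Y, X; P] / Var[X; P]

lemma regCoeff_mul_variance [IsProbabilityMeasure P] {X Y : Ω → ℝ} (hX : MemLp X 2 P) :
    regCoeff P Y X * Var[X; P] = cov[Y, X; P] := by
  rcases eq_or_ne Var[X; P] 0 with h | h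
  · have h0 : X =ᵐ[P] fun _ => P[X] := by
      have := (evariance_eq_zero_iff hX.1.aemeasurable).1 (by
        rw [← ofReal_variance hX, h]; simp)
      exact this
    have : cov[Y, X; P] = 0 := by
      rw [covariance, integral_eq_zero_of_ae]
      filter_upwards [h0] with ω hω
      simp [hω]
    rw [this, h, mul_zero]
  · rw [regCoeff, div_mul_cancel₀ _ h]

lemma regCoeff_nonneg {X Y : Ω → ℝ} (h : 0 ≤ cov[Y, X; P]) : 0 ≤ regCoeff P Y X :=
  div_nonneg h (variance_nonneg _ _)

/-- The residuals of the regression of a Gaussian vector on one of its coordinates are independent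
of that coordinate. -/
lemma indepFun_residual (hG : HasGaussianLaw (fun ω i => φ i ω) P) (k : ι) :
    IndepFun (φ k) (fun ω j => φ j ω - regCoeff P (φ j) (φ k) * φ k ω) P := by
  have := hG.isProbabilityMeasure
  let T : (ι → ℝ) →L[ℝ] (Unit → ℝ) × (ι → ℝ) :=
    (ContinuousLinearMap.pi fun _ => ContinuousLinearMap.proj k).prod
      (ContinuousLinearMap.pi fun j => ContinuousLinearMap.proj j
        - regCoeff P (φ j) (φ k) • ContinuousLinearMap.proj k)
  have h1 := hG.map_fun T
  have hL2 : ∀ j, MemLp (φ j) 2 P := fun j => (hG.eval j).memLp_two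
  have h2 := HasGaussianLaw.indepFun_of_covariance_eval (P := P) (X := fun _ : Unit => φ k)
    (Y := fun j ω => φ j ω - regCoeff P (φ j) (φ k) * φ k ω)
    (by simpa [T] using h1) (by
      intro _ j
      rw [covariance_fun_sub_right (hL2 k) (hL2 j) ((hL2 k).const_mul _),
        covariance_const_mul_right, covariance_self (hL2 k).1.aemeasurable,
        regCoeff_mul_variance (hL2 k), covariance_comm, sub_self])
  exact h2.comp (φ := fun f : Unit → ℝ => f ()) (ψ := id) (by fun_prop) measurable_id

/-- The configuration of the coordinates of a vector that exceed the level `L`. -/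
noncomputable def exceed (L : ℝ) (v : ι → ℝ) (i : ι) : Bool := decide (L ≤ v i)

omit [Fintype ι] in
lemma measurable_exceed (L : ℝ) : Measurable (exceed L : (ι → ℝ) → ι → Bool) := by
  refine measurable_pi_lambda _ fun i => ?_
  refine measurable_to_bool ?_
  have : (fun c : ι → ℝ => exceed L c i) ⁻¹' {true} = {c | L ≤ c i} := by
    ext; simp [exceed]
  rw [this]
  exact measurableSet_le measurable_const (measurable_pi_apply i)

/-- The excess, over the product, of the probability that two variables both exceed `L`. -/
noncomputable def pairCov (P : Measure Ω) (L : ℝ) (X Y : Ω → ℝ) : ℝ :=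
  P.real {ω | L ≤ X ω ∧ L ≤ Y ω} - P.real {ω | L ≤ X ω} * P.real {ω | L ≤ Y ω}

omit [Fintype ι] in
/-- A covariance involving the exceedance of one coordinate, written with two independent copies
`s`, `t` of this coordinate and the residuals `w`. -/
lemma integral_exceed_eq [IsProbabilityMeasure P] (L : ℝ) {X : Ω → ℝ} {W : Ω → ι → ℝ}
    (hX : AEMeasurable X P) (hW : AEMeasurable W P) (hind : IndepFun X W P) (a : ℝ → ℝ)
    (ha : Measurable a) (β : ι → ℝ) {D : (ι → Bool) → ℝ} (hDm : Measurable D) :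
    ∫ ω, a (X ω) * D (exceed L (fun j => W ω j + β j * X ω)) ∂P
      = ∫ z : ℝ × (ι → ℝ), a z.1 * D (exceed L (fun j => z.2 j + β j * z.1))
        ∂((P.map X).prod (P.map W)) := by
  rw [← (indepFun_iff_map_prod_eq_prod_map_map hX hW).1 hind, integral_map (by fun_prop)]
  refine Measurable.aestronglyMeasurable ?_
  refine (ha.comp measurable_fst).mul (hDm.comp ((measurable_exceed L).comp ?_))
  fun_prop

variable [DecidableEq ι]

/-- If two configurations are ordered, then a function bounded by one changes between them by at
most twice the number of coordinates that change. -/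
lemma abs_mul_sub_le_sum {a1 a2 : ℝ} {k : ι} {D : (ι → Bool) → ℝ} (hD : DependsOn D {k}ᶜ)
    (hD1 : ∀ b, |D b| ≤ 1) {b c : ι → Bool}
    (h : (a1 = a2) ∨ (a1 = 1 ∧ a2 = 0 ∧ c ≤ b) ∨ (a1 = 0 ∧ a2 = 1 ∧ b ≤ c)) :
    |(a1 - a2) * (D b - D c)| ≤ 2 * ∑ j ∈ Finset.univ.erase k,
      (a1 - a2) * ((if b j = true then 1 else 0) - (if c j = true then 1 else 0)) := by
  rcases h with h | h
  · simp [h]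
  have hterm : ∀ j, 0 ≤ (a1 - a2) * ((if b j = true then (1 : ℝ) else 0)
      - (if c j = true then 1 else 0)) := by
    intro j
    rcases h with ⟨rfl, rfl, h⟩ | ⟨rfl, rfl, h⟩ <;> have := h j <;> revert this <;>
      cases b j <;> cases c j <;> simp
  by_cases hbc : ∀ j ∈ ({k}ᶜ : Set ι), b j = c j
  · rw [hD hbc]
    simp only [sub_self, mul_zero, abs_zero]
    exact mul_nonneg zero_le_two (Finset.sum_nonneg fun j _ => hterm j)
  · push Not at hbc
    obtain ⟨j, hj, hne⟩ := hbc
    have h1 : (a1 - a2) * ((if b j = true then (1 : ℝ) else 0)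
      - (if c j = true then 1 else 0)) = 1 := by
      rcases h with ⟨rfl, rfl, h⟩ | ⟨rfl, rfl, h⟩ <;> have := h j <;> revert this hne <;>
        cases b j <;> cases c j <;> simp
    have h2 := Finset.single_le_sum (f := fun j => (a1 - a2) * ((if b j = true then (1 : ℝ) else 0)
      - (if c j = true then 1 else 0))) (fun j _ => hterm j)
      (show j ∈ Finset.univ.erase k by simpa using hj)
    simp only [h1] at h2
    have h3 : |a1 - a2| = 1 := by
      rcases h with ⟨rfl, rfl, h⟩ | ⟨rfl, rfl, h⟩ <;> simp
    rw [abs_mul, h3, one_mul]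
    have h4 := abs_sub (D b) (D c)
    have := hD1 b
    have := hD1 c
    linarith

/-- Positive association of Gaussian exceedances, in quantitative form: the covariance of the
exceedance of the `k`-th coordinate with any function of the other exceedances, bounded by one, is
at most twice the sum of its covariances with these. The regression coefficients are nonnegative,
so that, with the residuals fixed, raising the `k`-th coordinate can only create exceedances. -/
theorem abs_coordCov_le (hG : HasGaussianLaw (fun ω i => φ i ω) P) (L : ℝ) (k : ι)
    (hpos : ∀ j, 0 ≤ cov[φ j, φ k; P]) {D : (ι → Bool) → ℝ}
    (hD : DependsOn D {k}ᶜ) (hD1 : ∀ b, |D b| ≤ 1) :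
    |coordCov (P.map fun ω => exceed L (fun i => φ i ω)) k D|
      ≤ ∑ j ∈ Finset.univ.erase k, 2 * pairCov P L (φ j) (φ k) := by
  have := hG.isProbabilityMeasure
  have hφ : ∀ j, AEMeasurable (φ j) P := fun j => (hG.eval j).aemeasurable
  have hX : AEMeasurable (fun ω => exceed L (fun i => φ i ω)) P :=
    (measurable_exceed L).comp_aemeasurable (aemeasurable_pi_lambda _ hφ)
  set β : ι → ℝ := fun j => regCoeff P (φ j) (φ k)
  set W : Ω → ι → ℝ := fun ω j => φ j ω - β j * φ k ω
  have hW : AEMeasurable W P := aemeasurable_pi_lambda _ fun j => (hφ j).sub ((hφ k).const_mul _)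
  have hind : IndepFun (φ k) W P := indepFun_residual hG k
  have hβ : ∀ j, 0 ≤ β j := fun j => regCoeff_nonneg (hpos j)
  have := Measure.isProbabilityMeasure_map (hφ k)
  have := Measure.isProbabilityMeasure_map hW
  set μ := P.map (φ k)
  set κ := P.map W
  set a : ℝ → ℝ := fun s => if L ≤ s then 1 else 0
  have ha : Measurable a := Measurable.ite measurableSet_Ici measurable_const measurable_const
  have ha1 : ∀ s, |a s| ≤ 1 := by intro s; simp only [a]; split_ifs <;> simp
  have hrec : ∀ ω, exceed L (fun j => W ω j + β j * φ k ω) = exceed L (fun i => φ i ω) := by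
    intro ω; simp [W]
  set ξ : ℝ → (ι → ℝ) → ι → Bool := fun s w => exceed L (fun j => w j + β j * s)
  have hξ : Measurable (fun z : ℝ × (ι → ℝ) => ξ z.1 z.2) := by
    refine (measurable_exceed L).comp ?_
    fun_prop
  have hmono : ∀ s t w, s ≤ t → ξ s w ≤ ξ t w := by
    intro s t w hst j
    have h2 := mul_le_mul_of_nonneg_left hst (hβ j)
    have h3 : L ≤ w j + β j * s → L ≤ w j + β j * t := fun h => by linarith
    simp only [ξ, exceed]
    by_cases h : L ≤ w j + β j * s
    · simp [h, h3 h]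
    · simp [h]
  have hka : P.real {ω | L ≤ φ k ω} = ∫ s, a s ∂μ := by
    have : a = Set.indicator (Set.Ici L) 1 := by ext s; simp [a, Set.indicator_apply]
    rw [this, integral_indicator_one measurableSet_Ici,
      map_measureReal_apply_of_aemeasurable (hφ k) measurableSet_Ici]
    rfl
  -- every covariance with the exceedance of the `k`-th coordinate is symmetrized
  have hsym : ∀ E : (ι → Bool) → ℝ, (∀ b, |E b| ≤ 1) →
      ∫ z : (ℝ × ℝ) × (ι → ℝ), (a z.1.1 - a z.1.2) * (E (ξ z.1.1 z.2) - E (ξ z.1.2 z.2))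
          ∂((μ.prod μ).prod κ)
        = 2 * (∫ ω, a (φ k ω) * E (exceed L (fun i => φ i ω)) ∂P
          - P.real {ω | L ≤ φ k ω} * ∫ ω, E (exceed L (fun i => φ i ω)) ∂P) := by
    intro E hE
    have hEm : Measurable E := measurable_of_finite _
    rw [integral_symmetrize μ κ a (fun z => E (ξ z.1 z.2)) ha (hEm.comp hξ) ha1 (fun _ => hE _)]
    have h1 := integral_exceed_eq L (hφ k) hW hind a ha β hEm
    have h2 := integral_exceed_eq L (hφ k) hW hind (fun _ => 1) measurable_const β hEm
    simp only [hrec, one_mul] at h1 h2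
    rw [h1, h2, hka]
  have hco : coordCov (P.map fun ω => exceed L (fun i => φ i ω)) k D
      = ∫ ω, a (φ k ω) * D (exceed L (fun i => φ i ω)) ∂P
          - P.real {ω | L ≤ φ k ω} * ∫ ω, D (exceed L (fun i => φ i ω)) ∂P := by
    rw [coordCov, integral_map hX (measurable_of_finite _).aestronglyMeasurable,
      integral_map hX (measurable_of_finite _).aestronglyMeasurable,
      map_measureReal_apply_of_aemeasurable hX (Set.toFinite _).measurableSet]
    congr 1
    · refine integral_congr_ae (ae_of_all _ fun ω => ?_)
      simp [a, exceed]
    · congr 2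
      ext ω; simp [exceed]
  have hpair : ∀ j, pairCov P L (φ j) (φ k)
      = ∫ ω, a (φ k ω) * (if exceed L (fun i => φ i ω) j = true then 1 else 0) ∂P
        - P.real {ω | L ≤ φ k ω} * ∫ ω, (if exceed L (fun i => φ i ω) j = true then 1 else 0) ∂P := by
    intro j
    have hns : ∀ i, NullMeasurableSet {ω | L ≤ φ i ω} P :=
      fun i => nullMeasurableSet_le aemeasurable_const (hφ i)
    have hone : ∀ S : Set Ω, NullMeasurableSet S P →
        ∫ ω, S.indicator (fun _ => (1 : ℝ)) ω ∂P = P.real S := by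
      intro S hS
      rw [integral_indicator₀ hS]
      simp
    have e1 : ∫ ω, a (φ k ω) * (if exceed L (fun i => φ i ω) j = true then 1 else 0) ∂P
        = P.real {ω | L ≤ φ j ω ∧ L ≤ φ k ω} := by
      rw [show {ω | L ≤ φ j ω ∧ L ≤ φ k ω} = {ω | L ≤ φ j ω} ∩ {ω | L ≤ φ k ω} from rfl,
        ← hone _ ((hns j).inter (hns k))]
      refine integral_congr_ae (ae_of_all _ fun ω => ?_)
      simp only [a, exceed, Set.indicator_apply]
      by_cases h1 : L ≤ φ k ω <;> by_cases h2 : L ≤ φ j ω <;> simp [h1, h2]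
    have e2 : ∫ ω, (if exceed L (fun i => φ i ω) j = true then (1 : ℝ) else 0) ∂P
        = P.real {ω | L ≤ φ j ω} := by
      rw [← hone _ (hns j)]
      refine integral_congr_ae (ae_of_all _ fun ω => ?_)
      simp [exceed, Set.indicator_apply]
    rw [pairCov, e1, e2, mul_comm]
  have hbE : ∀ (j : ι) (b : ι → Bool), |if b j = true then (1 : ℝ) else 0| ≤ 1 := by
    intro j b; split_ifs <;> simp
  have hEint : ∀ E : (ι → Bool) → ℝ, (∀ b, |E b| ≤ 1) → Integrable (fun z : (ℝ × ℝ) × (ι → ℝ) =>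
      (a z.1.1 - a z.1.2) * (E (ξ z.1.1 z.2) - E (ξ z.1.2 z.2))) ((μ.prod μ).prod κ) := by
    intro E hE
    have hEm : Measurable E := measurable_of_finite _
    have m1 : Measurable (fun z : (ℝ × ℝ) × (ι → ℝ) => E (ξ z.1.1 z.2)) :=
      (hEm.comp hξ).comp (show Measurable fun z : (ℝ × ℝ) × (ι → ℝ) => (z.1.1, z.2) by fun_prop)
    have m2 : Measurable (fun z : (ℝ × ℝ) × (ι → ℝ) => E (ξ z.1.2 z.2)) :=
      (hEm.comp hξ).comp (show Measurable fun z : (ℝ × ℝ) × (ι → ℝ) => (z.1.2, z.2) by fun_prop)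
    refine Integrable.of_bound (C := 2 * 2) ?_ (ae_of_all _ fun z => ?_)
    · exact Measurable.aestronglyMeasurable (by fun_prop)
    · rw [norm_mul]
      have h1 : ‖a z.1.1 - a z.1.2‖ ≤ 2 := by
        refine (norm_sub_le _ _).trans ?_
        have := ha1 z.1.1; have := ha1 z.1.2
        simp only [Real.norm_eq_abs]; linarith
      have h2 : ‖E (ξ z.1.1 z.2) - E (ξ z.1.2 z.2)‖ ≤ 2 := by
        refine (norm_sub_le _ _).trans ?_
        have := hE (ξ z.1.1 z.2); have := hE (ξ z.1.2 z.2)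
        simp only [Real.norm_eq_abs]; linarith
      exact mul_le_mul h1 h2 (norm_nonneg _) zero_le_two
  have hmain : |2 * coordCov (P.map fun ω => exceed L (fun i => φ i ω)) k D|
      ≤ 2 * ∑ j ∈ Finset.univ.erase k, 2 * pairCov P L (φ j) (φ k) := by
    rw [hco, ← hsym D hD1]
    simp_rw [hpair, ← hsym (fun b => if b _ = true then 1 else 0) (hbE _)]
    rw [← integral_finsetSum _ (fun j _ => hEint _ (hbE j)), ← integral_const_mul]
    refine (abs_integral_le_integral_abs).trans (integral_mono (hEint D hD1).abs
      ((integrable_finsetSum _ fun j _ => hEint _ (hbE j)).const_mul 2) fun z => ?_)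
    refine abs_mul_sub_le_sum hD hD1 ?_
    simp only [a]
    by_cases h1 : L ≤ z.1.1 <;> by_cases h2 : L ≤ z.1.2 <;> simp only [h1, h2, if_true, if_false]
    · left; trivial
    · right; left; exact ⟨trivial, trivial, hmono _ _ _ (by linarith)⟩
    · right; right; exact ⟨trivial, trivial, hmono _ _ _ (by linarith)⟩
    · left; trivial
  rw [abs_mul, abs_two] at hmain
  linarith

end Association

/-! ### Joint exceedances of two Gaussian variables -/

section PairBounds

variable {Ω : Type*} [MeasurableSpace Ω] {P : Measure Ω} {X Y : Ω → ℝ}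

lemma gaussian_tail_le (hX : HasGaussianLaw X P) (h0 : P[X] = 0) {v : ℝ}
    (hv : Var[X; P] ≤ v) {ε : ℝ} (hε : 0 ≤ ε) :
    P.real {ω | ε ≤ X ω} ≤ Real.exp (-ε ^ 2 / (2 * v)) := by
  have hmap := hX.map_eq_gaussianReal
  rw [h0] at hmap
  have hv0 : 0 ≤ v := (variance_nonneg _ _).trans hv
  have hsub : HasSubgaussianMGF X v.toNNReal P := by
    constructor
    · intro t
      have h := integrable_exp_mul_gaussianReal (μ := 0) (v := Var[X; P].toNNReal) t
      rw [← hmap] at h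
      exact (integrable_map_measure (by fun_prop) hX.aemeasurable).1 h
    · intro t
      rw [mgf_gaussianReal hmap, Real.coe_toNNReal _ hv0, Real.coe_toNNReal _ (variance_nonneg _ _)]
      gcongr
      nlinarith [mul_le_mul_of_nonneg_right hv (sq_nonneg t)]
  have := hsub.measure_ge_le hε
  rwa [Real.coe_toNNReal _ hv0] at this

lemma gaussianReal_real_Ico_le {v : NNReal} (hv : 1 / 2 ≤ (v : ℝ)) {a b : ℝ} (ha : 0 ≤ a)
    (hab : a ≤ b) :
    (gaussianReal 0 v).real (Set.Ico a b) ≤ (b - a) * Real.exp (-a ^ 2 / (2 * v)) := by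
  have hv0 : v ≠ 0 := by rintro rfl; norm_num at hv
  have hπ := Real.pi_gt_three
  have h1 : (gaussianReal 0 v) (Set.Ico a b)
      ≤ ENNReal.ofReal (Real.exp (-a ^ 2 / (2 * v))) * ENNReal.ofReal (b - a) := by
    rw [gaussianReal_apply 0 hv0, ← Real.volume_Ico (a := a) (b := b), ← setLIntegral_const]
    refine setLIntegral_mono measurable_const fun x hx => ENNReal.ofReal_le_ofReal ?_
    rw [gaussianPDFReal, sub_zero]
    have h2 : (√(2 * Real.pi * v))⁻¹ ≤ 1 := by
      refine inv_le_one_of_one_le₀ (Real.one_le_sqrt.2 ?_)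
      nlinarith
    calc (√(2 * Real.pi * v))⁻¹ * Real.exp (-x ^ 2 / (2 * v))
        ≤ 1 * Real.exp (-x ^ 2 / (2 * v)) := by gcongr
      _ ≤ Real.exp (-a ^ 2 / (2 * v)) := by
        rw [one_mul]
        have : a ^ 2 ≤ x ^ 2 := pow_le_pow_left₀ ha hx.1 2
        gcongr
  rw [measureReal_def]
  refine ENNReal.toReal_le_of_le_ofReal (by have := Real.exp_pos (-a ^ 2 / (2 * v)); nlinarith) ?_
  rw [mul_comm (b - a), ENNReal.ofReal_mul (Real.exp_pos _).le]
  exact h1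

/-- Two strongly correlated variables: if both exceed `L`, then their sum exceeds `2 L`. -/
lemma pairCov_le_of_variance_add_le [IsProbabilityMeasure P]
    (hG : HasGaussianLaw (fun ω => (X ω, Y ω)) P) (hX0 : P[X] = 0) (hY0 : P[Y] = 0) {L V : ℝ}
    (hL : 0 ≤ L) (hV : Var[X; P] + 2 * cov[X, Y; P] + Var[Y; P] ≤ V) :
    pairCov P L X Y ≤ Real.exp (-(2 * L) ^ 2 / (2 * V)) := by
  have hX := hG.fst
  have hY := hG.snd
  have h1 := gaussian_tail_le (v := V) (ε := 2 * L) hG.add (by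
    rw [integral_add' hX.integrable hY.integrable, hX0, hY0, add_zero]) (by
    rw [variance_add hX.memLp_two hY.memLp_two]; linarith) (by linarith)
  have h2 : P.real {ω | L ≤ X ω ∧ L ≤ Y ω} ≤ P.real {ω | 2 * L ≤ (X + Y) ω} :=
    measureReal_mono (fun ω hω => by
      simp only [Set.mem_ofPred_eq, Pi.add_apply] at hω ⊢; linarith [hω.1, hω.2])
  have h3 : 0 ≤ P.real {ω | L ≤ X ω} * P.real {ω | L ≤ Y ω} := by positivity
  rw [pairCov]; linarith

/-- Two weakly correlated variables, with regression coefficient `β`: unless `|X| > 2 L`, the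
residual of `Y` has to fall into an interval of length `4 β L` around `L`. -/
lemma pairCov_le_of_regCoeff_le [IsProbabilityMeasure P]
    (hG : HasGaussianLaw (fun ω => (X ω, Y ω)) P) (hX0 : P[X] = 0) (hY0 : P[Y] = 0) {L G : ℝ}
    (hL : 0 ≤ L) (hXG : Var[X; P] ≤ G) (hYG : Var[Y; P] ≤ G) (hcov : 0 ≤ cov[Y, X; P])
    (hβ : regCoeff P Y X ≤ 1 / 2)
    (hv : 1 / 2 ≤ Var[Y; P] - regCoeff P Y X * cov[Y, X; P]) :
    pairCov P L Y X ≤ 2 * Real.exp (-(2 * L) ^ 2 / (2 * G))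
      + Real.exp (-L ^ 2 / (2 * G)) * (4 * regCoeff P Y X * L
        * Real.exp (-(L - 2 * regCoeff P Y X * L) ^ 2 / (2 * G))) := by
  have hX := hG.fst
  have hY := hG.snd
  have hβ0 : 0 ≤ regCoeff P Y X := regCoeff_nonneg hcov
  have hreg := regCoeff_mul_variance (P := P) (Y := Y) hX.memLp_two
  set β := regCoeff P Y X
  set ψ : Ω → ℝ := fun ω => Y ω - β * X ω
  let T : ℝ × ℝ →L[ℝ] ℝ × ℝ := (ContinuousLinearMap.fst ℝ ℝ ℝ).prod
    (ContinuousLinearMap.snd ℝ ℝ ℝ - β • ContinuousLinearMap.fst ℝ ℝ ℝ)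
  have hXψ : HasGaussianLaw (fun ω => (X ω, ψ ω)) P := by simpa [T] using hG.map_fun T
  have hψ := hXψ.snd
  have hcov0 : cov[X, ψ; P] = 0 := by
    rw [covariance_fun_sub_right hX.memLp_two hY.memLp_two (hX.memLp_two.const_mul _),
      covariance_const_mul_right, covariance_self hX.aemeasurable, hreg, covariance_comm, sub_self]
  have hind : IndepFun X ψ P := hXψ.indepFun_of_covariance_eq_zero hcov0
  have hψ0 : P[ψ] = 0 := by
    rw [integral_sub hY.integrable (hX.integrable.const_mul _), integral_const_mul, hX0, hY0]
    simp
  have hψv : Var[ψ; P] = Var[Y; P] - β * cov[Y, X; P] := by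
    have hψ2 : cov[ψ, ψ; P] = cov[Y, ψ; P] := by
      rw [covariance_fun_sub_left hY.memLp_two (hX.memLp_two.const_mul _) hψ.memLp_two,
        covariance_const_mul_left, hcov0, mul_zero, sub_zero]
    rw [← covariance_self hψ.aemeasurable, hψ2,
      covariance_fun_sub_right hY.memLp_two hY.memLp_two (hX.memLp_two.const_mul _),
      covariance_self hY.aemeasurable, covariance_const_mul_right]
  have hψG : Var[ψ; P] ≤ G := by
    have := mul_nonneg hβ0 hcov
    linarith
  have hG0 : 0 < G := by linarith
  have hnX : ∀ c, NullMeasurableSet {ω | c ≤ X ω} P :=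
    fun c => nullMeasurableSet_le aemeasurable_const hX.aemeasurable
  -- the two tail events
  have t1 : P.real {ω | 2 * L ≤ X ω} ≤ Real.exp (-(2 * L) ^ 2 / (2 * G)) :=
    gaussian_tail_le hX hX0 hXG (by linarith)
  have t2 : P.real {ω | 2 * L ≤ -X ω} ≤ Real.exp (-(2 * L) ^ 2 / (2 * G)) :=
    gaussian_tail_le (X := fun ω => -X ω) hX.fun_neg (by rw [integral_neg, hX0, neg_zero])
      (by rw [variance_fun_neg]; exact hXG) (by linarith)
  have t3 : P.real {ω | L ≤ X ω} ≤ Real.exp (-L ^ 2 / (2 * G)) := gaussian_tail_le hX hX0 hXG hL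
  -- the upper bound on the joint probability
  have hprod : P.real {ω | L ≤ X ω ∧ L - 2 * β * L ≤ ψ ω}
      = P.real {ω | L ≤ X ω} * P.real {ω | L - 2 * β * L ≤ ψ ω} := by
    have := hind.measure_inter_preimage_eq_mul (Set.Ici L) (Set.Ici (L - 2 * β * L))
      measurableSet_Ici measurableSet_Ici
    simp only [measureReal_def, ← ENNReal.toReal_mul]
    exact congrArg ENNReal.toReal this
  have u1 : P.real {ω | L ≤ Y ω ∧ L ≤ X ω} ≤ P.real {ω | 2 * L ≤ X ω}
      + P.real {ω | L ≤ X ω} * P.real {ω | L - 2 * β * L ≤ ψ ω} := by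
    rw [← hprod]
    refine (measureReal_mono ?_).trans (measureReal_union_le _ _)
    rintro ω ⟨h1, h2⟩
    by_cases h : 2 * L ≤ X ω
    · exact Or.inl h
    · refine Or.inr ⟨h2, ?_⟩
      have := mul_le_mul_of_nonneg_left (not_le.1 h).le hβ0
      simp only [ψ]; linarith
  -- the lower bound on the marginal probability
  have l1 : P.real {ω | L + 2 * β * L ≤ ψ ω} ≤ P.real {ω | L ≤ Y ω} + P.real {ω | 2 * L ≤ -X ω} := by
    refine (measureReal_mono ?_).trans (measureReal_union_le _ _)
    intro ω h1
    by_cases h : 2 * L ≤ -X ω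
    · exact Or.inr h
    · refine Or.inl ?_
      have := mul_le_mul_of_nonneg_left (not_le.1 h).le hβ0
      simp only [ψ, Set.mem_ofPred_eq] at h1 ⊢; linarith
  have w1 : P.real {ω | L - 2 * β * L ≤ ψ ω} - P.real {ω | L + 2 * β * L ≤ ψ ω}
      ≤ 4 * β * L * Real.exp (-(L - 2 * β * L) ^ 2 / (2 * G)) := by
    have hβL : 0 ≤ β * L := mul_nonneg hβ0 hL
    have hβL2 : 2 * β * L ≤ L := by nlinarith
    have hmap := hψ.map_eq_gaussianReal
    rw [hψ0] at hmap
    have e : ∀ c, P.real {ω | c ≤ ψ ω} = (gaussianReal 0 Var[ψ; P].toNNReal).real (Set.Ici c) := by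
      intro c
      rw [← hmap, map_measureReal_apply_of_aemeasurable hψ.aemeasurable measurableSet_Ici]
      rfl
    have hd := measureReal_union (μ := gaussianReal 0 Var[ψ; P].toNNReal)
      (s₁ := Set.Ico (L - 2 * β * L) (L + 2 * β * L)) (s₂ := Set.Ici (L + 2 * β * L))
      (Set.disjoint_left.2 fun x hx hx' => not_lt.2 hx' hx.2) measurableSet_Ici
    rw [Set.Ico_union_Ici_eq_Ici (by linarith)] at hd
    have hvv : (Var[ψ; P].toNNReal : ℝ) = Var[ψ; P] := Real.coe_toNNReal _ (variance_nonneg _ _)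
    have hI := gaussianReal_real_Ico_le (v := Var[ψ; P].toNNReal) (by rw [hvv, hψv]; exact hv)
      (a := L - 2 * β * L) (b := L + 2 * β * L) (by linarith) (by linarith)
    rw [e, e, hd, add_sub_cancel_right]
    refine hI.trans ?_
    rw [hvv]
    have h4 : L + 2 * β * L - (L - 2 * β * L) = 4 * β * L := by ring
    rw [h4]
    have hVpos : 0 < Var[ψ; P] := by linarith
    refine mul_le_mul_of_nonneg_left (Real.exp_le_exp.2 ?_) (by linarith)
    rw [neg_div, neg_div, neg_le_neg_iff]
    gcongr
  have hp0 : 0 ≤ P.real {ω | L ≤ X ω} := measureReal_nonneg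
  have hp1 : P.real {ω | L ≤ X ω} ≤ 1 := measureReal_le_one
  have hq0 : 0 ≤ P.real {ω | 2 * L ≤ -X ω} := measureReal_nonneg
  have hΔ : 0 ≤ 4 * β * L * Real.exp (-(L - 2 * β * L) ^ 2 / (2 * G)) := by positivity
  calc pairCov P L Y X
      ≤ P.real {ω | 2 * L ≤ X ω} + P.real {ω | L ≤ X ω} * P.real {ω | 2 * L ≤ -X ω}
        + P.real {ω | L ≤ X ω} *
          (P.real {ω | L - 2 * β * L ≤ ψ ω} - P.real {ω | L + 2 * β * L ≤ ψ ω}) := by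
        rw [pairCov]
        have := mul_le_mul_of_nonneg_left l1 hp0
        nlinarith
    _ ≤ Real.exp (-(2 * L) ^ 2 / (2 * G)) + 1 * Real.exp (-(2 * L) ^ 2 / (2 * G))
        + Real.exp (-L ^ 2 / (2 * G)) * (4 * β * L
        * Real.exp (-(L - 2 * β * L) ^ 2 / (2 * G))) := by
        exact add_le_add (add_le_add t1 (mul_le_mul hp1 t2 hq0 zero_le_one))
          ((mul_le_mul_of_nonneg_left w1 hp0).trans (mul_le_mul_of_nonneg_right t3 hΔ))
    _ = _ := by ring

end PairBounds

/-! ### Transition probabilities and exit time of simple random walk -/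

section Walk

variable {d : ℕ}

/-- The transition probabilities of simple random walk from the origin, defined recursively. -/
noncomputable def heatKernel (d : ℕ) : ℕ → (Fin d → ℤ) → ℝ
  | 0, z => if z = 0 then 1 else 0
  | k + 1, z => (∑ e : Fin d × Bool, heatKernel d k (z - step e)) / (2 * d)

instance [NeZero d] : IsProbabilityMeasure (uniformOn (Set.univ : Set (Fin d × Bool))) :=
  isProbabilityMeasure_uniformOn Set.finite_univ Set.univ_nonempty

instance [NeZero d] : IsProbabilityMeasure (stepLaw d) := by
  unfold stepLaw; infer_instance

lemma exists_eq_comp_restrict {k : ℕ} {F : (ℕ → Fin d × Bool) → ℝ} (hF : DependsOn F (Set.Iio k)) :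
    ∃ F' : (Finset.range k → Fin d × Bool) → ℝ,
      ∀ s, F s = F' (fun i => s i) := by
  obtain ⟨g, hg⟩ := dependsOn_iff_exists_comp.1
    (hF.mono (show Set.Iio k ⊆ ((Finset.range k : Finset ℕ) : Set ℕ) by intro i; simp))
  exact ⟨g, fun s => congrFun hg s⟩

lemma measurable_of_dependsOn {k : ℕ} {F : (ℕ → Fin d × Bool) → ℝ}
    (hF : DependsOn F (Set.Iio k)) : Measurable F := by
  obtain ⟨F', hF'⟩ := exists_eq_comp_restrict hF
  rw [show F = F' ∘ fun s (i : Finset.range k) => s i from funext hF']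
  exact (measurable_of_finite F').comp (by fun_prop)

lemma integrable_of_dependsOn [NeZero d] {k : ℕ} {F : (ℕ → Fin d × Bool) → ℝ}
    (hF : DependsOn F (Set.Iio k)) : Integrable F (stepLaw d) := by
  obtain ⟨F', hF'⟩ := exists_eq_comp_restrict hF
  obtain ⟨C, hC⟩ := (Set.finite_range fun x => ‖F' x‖).bddAbove
  refine Integrable.of_bound (measurable_of_dependsOn hF).aestronglyMeasurable C
    (ae_of_all _ fun s => ?_)
  rw [hF']
  exact hC ⟨_, rfl⟩

lemma measurableSet_of_dependsOn {k : ℕ} {A : Set (ℕ → Fin d × Bool)}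
    (hA : DependsOn (· ∈ A) (Set.Iio k)) : MeasurableSet A := by
  classical
  have h : DependsOn (A.indicator fun _ => (1 : ℝ)) (Set.Iio k) := by
    intro x y hxy
    simp [Set.indicator_apply, show (x ∈ A) = (y ∈ A) from hA hxy]
  have h2 := measurable_of_dependsOn h (measurableSet_singleton (1 : ℝ))
  have h3 : A.indicator (fun _ => (1 : ℝ)) ⁻¹' {1} = A := by
    ext s; by_cases hs : s ∈ A <;> simp [hs]
  rwa [h3] at h2

/-- The `k`-th increment is uniformly distributed and independent of the previous ones. -/
lemma integral_ite_step [NeZero d] {k : ℕ} {F : (ℕ → Fin d × Bool) → ℝ}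
    (hF : DependsOn F (Set.Iio k)) (e : Fin d × Bool) :
    ∫ s, (if s k = e then F s else 0) ∂(stepLaw d) = (∫ s, F s ∂(stepLaw d)) / (2 * d) := by
  obtain ⟨F', hF'⟩ := exists_eq_comp_restrict hF
  have hind : iIndepFun (fun i (s : ℕ → Fin d × Bool) => s i) (stepLaw d) :=
    iIndepFun_infinitePi (X := fun _ b => b) (fun i => measurable_id)
  have h2 := hind.indepFun_finset (Finset.range k) {k} (by simp) (fun i => by fun_prop)
  let a : (({k} : Finset ℕ) → Fin d × Bool) → ℝ := fun g => if g ⟨k, by simp⟩ = e then 1 else 0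
  have h3 := h2.comp (φ := F') (ψ := a) (measurable_of_finite _) (measurable_of_finite _)
  have h4 := h3.integral_mul_eq_mul_integral
    ((measurable_of_finite F').comp (by fun_prop)).aestronglyMeasurable
    ((measurable_of_finite a).comp (by fun_prop)).aestronglyMeasurable
  have e1 : ∀ s : ℕ → Fin d × Bool, (if s k = e then F s else 0)
      = ((F' ∘ fun (s : ℕ → Fin d × Bool) (i : Finset.range k) => s i)
        * (a ∘ fun (s : ℕ → Fin d × Bool) (i : ({k} : Finset ℕ)) => s i)) s := by
    intro s; simp [a, hF']
  have e2 : ∫ s, (a ∘ fun (s : ℕ → Fin d × Bool) (i : ({k} : Finset ℕ)) => s i) s ∂(stepLaw d)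
      = 1 / (2 * d) := by
    have hpre : {s : ℕ → Fin d × Bool | s k = e} = (fun s => s k) ⁻¹' {e} := by ext; simp
    have : (a ∘ fun (s : ℕ → Fin d × Bool) (i : ({k} : Finset ℕ)) => s i)
        = Set.indicator {s : ℕ → Fin d × Bool | s k = e} 1 := by
      ext s; simp [a, Set.indicator_apply]
    rw [this, integral_indicator_one (by rw [hpre]; exact measurable_pi_apply k (by simp)), hpre,
      measureReal_def, ← Measure.map_apply (measurable_pi_apply k) (by simp), stepLaw,
      Measure.infinitePi_map_eval, uniformOn_univ]
    simp [Fintype.card_prod, mul_comm]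
  rw [integral_congr_ae (ae_of_all _ e1), h4, e2]
  simp only [Function.comp_def, ← hF']
  ring

/-- Conditioning on the last step of the walk. -/
lemma integral_last_step [NeZero d] {k : ℕ} {F : (ℕ → Fin d × Bool) → Fin d × Bool → ℝ}
    (hF : ∀ e, DependsOn (fun s => F s e) (Set.Iio k)) :
    ∫ s, F s (s k) ∂(stepLaw d) = ∫ s, (∑ e, F s e) / (2 * d) ∂(stepLaw d) := by
  have h1 : ∀ s : ℕ → Fin d × Bool, F s (s k) = ∑ e, if s k = e then F s e else 0 := by
    intro s; simp
  have hi : ∀ e, Integrable (fun s : ℕ → Fin d × Bool => if s k = e then F s e else 0)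
      (stepLaw d) := by
    intro e
    refine integrable_of_dependsOn (k := k + 1) ?_
    intro x y hxy
    have hk : x k = y k := hxy k (by simp)
    have : F x e = F y e := hF e fun i hi => hxy i (by simp only [Set.mem_Iio] at hi ⊢; omega)
    simp [hk, this]
  rw [integral_congr_ae (ae_of_all _ h1), integral_finsetSum _ fun e _ => hi e, integral_div,
    integral_finsetSum _ fun e _ => integrable_of_dependsOn (hF e), Finset.sum_div]
  exact Finset.sum_congr rfl fun e _ => integral_ite_step (hF e) e

lemma dependsOn_walk (x : Fin d → ℤ) (k : ℕ) : DependsOn (walk x k) (Set.Iio k) := by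
  intro s t h
  simp only [walk]
  congr 1
  exact Finset.sum_congr rfl fun j hj => by rw [h j (by simpa using hj)]

lemma walk_succ (x : Fin d → ℤ) (k : ℕ) (s : ℕ → Fin d × Bool) :
    walk x (k + 1) s = walk x k s + step (s k) := by
  simp [walk, Finset.sum_range_succ, add_assoc]

lemma walk_eq_iff (x y : Fin d → ℤ) (k : ℕ) (s : ℕ → Fin d × Bool) :
    walk x k s = y ↔ walk 0 k s = y - x := by
  simp only [walk, zero_add]
  constructor
  · rintro rfl; simp
  · intro h; rw [h]; simp

lemma measurableSet_walk_eq (x y : Fin d → ℤ) (k : ℕ) : MeasurableSet {s | walk x k s = y} := by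
  refine measurableSet_of_dependsOn (k := k) fun s t h => ?_
  simp [dependsOn_walk x k h]

lemma measureReal_walk_zero_eq [NeZero d] (k : ℕ) (z : Fin d → ℤ) :
    (stepLaw d).real {s | walk 0 k s = z} = heatKernel d k z := by
  induction k generalizing z with
  | zero =>
    by_cases hz : z = 0
    · simp [heatKernel, walk, hz]
    · have : ∀ s : ℕ → Fin d × Bool, ¬ (walk 0 0 s = z) := by
        intro s h; exact hz (by simpa [walk] using h.symm)
      simp [heatKernel, hz, this]
  | succ k ih =>
    have h := integral_last_step (d := d) (k := k)
      (F := fun s e => if walk 0 k s = z - step e then (1 : ℝ) else 0) (by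
        intro e s t h
        simp [dependsOn_walk 0 k h])
    have hone : ∀ (m : ℕ) (w : Fin d → ℤ), (stepLaw d).real {s | walk 0 m s = w}
        = ∫ s, (if walk 0 m s = w then (1 : ℝ) else 0) ∂(stepLaw d) := by
      intro m w
      rw [← integral_indicator_one (measurableSet_walk_eq 0 w m)]
      congr 1
      ext s
      simp [Set.indicator_apply]
    rw [hone, heatKernel]
    have e1 : ∀ s : ℕ → Fin d × Bool, (if walk 0 (k + 1) s = z then (1 : ℝ) else 0)
        = if walk 0 k s = z - step (s k) then (1 : ℝ) else 0 := by
      intro s; rw [walk_succ]; simp only [eq_sub_iff_add_eq]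
    rw [integral_congr_ae (ae_of_all _ e1), h, integral_div, integral_finsetSum]
    · simp_rw [← hone, ih]
    · intro e _
      refine integrable_of_dependsOn (k := k) ?_
      intro s t h
      simp [dependsOn_walk 0 k h]

lemma measureReal_walk_eq [NeZero d] (k : ℕ) (x y : Fin d → ℤ) :
    (stepLaw d).real {s | walk x k s = y} = heatKernel d k (y - x) := by
  simp_rw [walk_eq_iff x y, measureReal_walk_zero_eq]

lemma heatKernel_nonneg (k : ℕ) (z : Fin d → ℤ) : 0 ≤ heatKernel d k z := by
  induction k generalizing z with
  | zero => simp only [heatKernel]; split_ifs <;> simp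
  | succ k ih => exact div_nonneg (Finset.sum_nonneg fun e _ => ih _) (by positivity)

lemma sum_heatKernel_le_one [NeZero d] (k : ℕ) (S : Finset (Fin d → ℤ)) :
    ∑ z ∈ S, heatKernel d k z ≤ 1 := by
  simp_rw [← measureReal_walk_zero_eq]
  rw [← measureReal_biUnion_finset]
  · exact measureReal_le_one
  · intro z _ w _ hzw
    exact Set.disjoint_left.2 fun s hs hs' => hzw (hs.symm.trans hs')
  · intro z _; exact measurableSet_walk_eq 0 z k

lemma step_injective : Function.Injective (step : Fin d × Bool → Fin d → ℤ) := by
  rintro ⟨i, a⟩ ⟨j, b⟩ h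
  have h1 := congrFun h i
  have hij : i = j := by
    by_contra hij
    simp only [step, Pi.single_eq_same, Pi.single_eq_of_ne hij] at h1
    cases a <;> simp at h1
  subst hij
  simp only [step, Pi.single_eq_same] at h1
  cases a <;> cases b <;> simp_all

lemma heatKernel_one_le (z : Fin d → ℤ) : heatKernel d 1 z ≤ 1 / (2 * d) := by
  simp only [heatKernel]
  refine div_le_div_of_nonneg_right ?_ (by positivity)
  rw [Finset.sum_ite, Finset.sum_const_zero, add_zero, Finset.sum_const, nsmul_one]
  have : (Finset.univ.filter fun e : Fin d × Bool => z - step e = 0).card ≤ 1 := by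
    rw [Finset.card_le_one]
    intro a ha b hb
    simp only [Finset.mem_filter, Finset.mem_univ, true_and, sub_eq_zero] at ha hb
    exact step_injective (ha.symm.trans hb)
  exact_mod_cast this

lemma lt_exitTime_iff (n : ℕ) (x : Fin d → ℤ) (k : ℕ) (s : ℕ → Fin d × Bool) :
    (k : WithTop ℕ) < exitTime n x s ↔ ∀ j ≤ k, walk x j s ∉ boxBoundary d n := by
  have := (hittingAfter_le_iff (u := walk x) (s := boxBoundary d n) (n := 0) (i := k) (ω := s)).not
  rw [not_le] at this
  rw [exitTime]
  refine this.trans ?_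
  simp

lemma dependsOn_lt_exitTime (n : ℕ) (x : Fin d → ℤ) (k : ℕ) :
    DependsOn (fun s => (k : WithTop ℕ) < exitTime n x s) (Set.Iio k) := by
  intro s t h
  simp only [lt_exitTime_iff]
  refine propext (forall₂_congr fun j hj => ?_)
  rw [dependsOn_walk x j fun i hi => h i (by simp only [Set.mem_Iio] at hi ⊢; omega)]

/-- The points of the box that are not in its boundary. -/
def IsInterior (n : ℕ) (x : Fin d → ℤ) : Prop := ∀ i, 0 < x i ∧ x i < n

lemma isInterior_iff (n : ℕ) (x : Fin d → ℤ) :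
    IsInterior n x ↔ x ∈ box d n ∧ x ∉ boxBoundary d n := by
  simp only [IsInterior, boxBoundary, Finset.mem_Icc, Pi.le_def, Set.mem_ofPred_eq, not_and,
    not_exists, not_or]
  constructor
  · intro h
    exact ⟨⟨fun i => (h i).1.le, fun i => (h i).2.le⟩, fun _ i => ⟨(h i).1.ne', (h i).2.ne⟩⟩
  · rintro ⟨h1, h2⟩ i
    exact ⟨lt_of_le_of_ne (h1.1 i) (Ne.symm (h2 h1 i).1), lt_of_le_of_ne (h1.2 i) (h2 h1 i).2⟩

lemma IsInterior.add_step_mem {n : ℕ} {x : Fin d → ℤ} (h : IsInterior n x) (e : Fin d × Bool) :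
    x + step e ∈ box d n := by
  simp only [Finset.mem_Icc, Pi.le_def, Pi.add_apply, step]
  have : ∀ i, -1 ≤ (Pi.single e.1 (if e.2 then 1 else -1) : Fin d → ℤ) i
      ∧ (Pi.single e.1 (if e.2 then 1 else -1) : Fin d → ℤ) i ≤ 1 := by
    intro i
    rcases eq_or_ne i e.1 with rfl | hi
    · rw [Pi.single_eq_same]; split_ifs <;> simp
    · rw [Pi.single_eq_of_ne hi]; simp
  constructor <;> intro i <;> have := this i <;> have := h i <;> omega

lemma isInterior_walk {n : ℕ} {x : Fin d → ℤ} (hx : IsInterior n x) {k : ℕ}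
    {s : ℕ → Fin d × Bool} (h : (k : WithTop ℕ) < exitTime n x s) : IsInterior n (walk x k s) := by
  rw [lt_exitTime_iff] at h
  induction k with
  | zero => simpa [walk] using hx
  | succ k ih =>
    rw [isInterior_iff]
    refine ⟨?_, h _ le_rfl⟩
    rw [walk_succ]
    exact (ih fun j hj => h j (by omega)).add_step_mem _

/-- A function, nonnegative on the box, whose mean decreases by exactly one at each step of the
walk. -/
def potential (n : ℕ) (x : Fin d → ℤ) : ℝ := ∑ i, (x i : ℝ) * (n - x i)

lemma potential_nonneg {n : ℕ} {x : Fin d → ℤ} (hx : x ∈ box d n) : 0 ≤ potential n x := by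
  simp only [Finset.mem_Icc, Pi.le_def] at hx
  refine Finset.sum_nonneg fun i _ => mul_nonneg (by exact_mod_cast hx.1 i) ?_
  have : (x i : ℝ) ≤ n := by exact_mod_cast hx.2 i
  linarith

lemma potential_le {n : ℕ} {x : Fin d → ℤ} (hx : x ∈ box d n) :
    potential n x ≤ d * (n : ℝ) ^ 2 := by
  simp only [Finset.mem_Icc, Pi.le_def] at hx
  have : ∀ i ∈ Finset.univ, (x i : ℝ) * (n - x i) ≤ (n : ℝ) ^ 2 := by
    intro i _
    have h1 : (0 : ℝ) ≤ x i := by exact_mod_cast hx.1 i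
    have h2 : (x i : ℝ) ≤ n := by exact_mod_cast hx.2 i
    nlinarith
  simpa [potential] using Finset.sum_le_sum this

lemma sum_potential_add_step [NeZero d] (n : ℕ) (x : Fin d → ℤ) :
    (∑ e, potential n (x + step e)) / (2 * d) = potential n x - 1 := by
  have key : ∀ e : Fin d × Bool, potential n (x + step e)
      = potential n x + (if e.2 then (1 : ℝ) else -1) * (n - 2 * x e.1) - 1 := by
    rintro ⟨i, b⟩
    have : ∀ j, ((x + step (i, b)) j : ℝ) * (n - ((x + step (i, b)) j : ℤ))
        = (x j : ℝ) * (n - x j)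
          + if j = i then ((if b then (1 : ℝ) else -1) * (n - 2 * x i) - 1) else 0 := by
      intro j
      rcases eq_or_ne j i with rfl | hj
      · cases b <;> simp [step] <;> ring
      · simp [step, hj]
    simp only [potential, this, Finset.sum_add_distrib, Finset.sum_ite_eq', Finset.mem_univ, if_true]
    ring
  have hd : (d : ℝ) ≠ 0 := Nat.cast_ne_zero.2 (NeZero.ne d)
  simp_rw [key, Fintype.sum_prod_type]
  simp only [Fintype.sum_bool, if_true, Bool.false_eq_true, if_false]
  have : ∀ i : Fin d, potential n x + 1 * ((n : ℝ) - 2 * x i) - 1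
      + (potential n x + -1 * ((n : ℝ) - 2 * x i) - 1) = 2 * (potential n x - 1) := by
    intro i; ring
  simp_rw [this]
  simp
  field_simp

/-- The expected exit time from the box is at most the potential at the starting point. -/
lemma sum_measureReal_lt_exitTime_le [NeZero d] {n : ℕ} {x : Fin d → ℤ} (hx : IsInterior n x)
    (K : ℕ) :
    ∑ k ∈ Finset.range K, (stepLaw d).real {s | (k : WithTop ℕ) < exitTime n x s}
      ≤ d * (n : ℝ) ^ 2 := by
  classical
  set b : ℕ → ℝ := fun k => ∫ s, (if (k : WithTop ℕ) < exitTime n x s then potential n (walk x k s)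
    else 0) ∂(stepLaw d) with hb
  have hdep : ∀ (k : ℕ) (g : (Fin d → ℤ) → ℝ), DependsOn (fun s =>
      if (k : WithTop ℕ) < exitTime n x s then g (walk x k s) else 0) (Set.Iio k) := by
    intro k g s t h
    simp only [show ((k : WithTop ℕ) < exitTime n x s) = ((k : WithTop ℕ) < exitTime n x t) from
      dependsOn_lt_exitTime n x k h, dependsOn_walk x k h]
  have hb0 : ∀ k, 0 ≤ b k := by
    intro k
    refine integral_nonneg fun s => ?_
    simp only [Pi.zero_apply]
    split_ifs with h
    · exact potential_nonneg ((isInterior_iff n _).1 (isInterior_walk hx h)).1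
    · exact le_rfl
  have hstep : ∀ k, b (k + 1)
      ≤ b k - (stepLaw d).real {s | (k : WithTop ℕ) < exitTime n x s} := by
    intro k
    have h := integral_last_step (d := d) (k := k)
      (F := fun s e => if (k : WithTop ℕ) < exitTime n x s then potential n (walk x k s + step e)
        else 0) (fun e => hdep k (fun w => potential n (w + step e)))
    have h1 : b (k + 1) ≤ ∫ s, (if (k : WithTop ℕ) < exitTime n x s
        then potential n (walk x k s + step (s k)) else 0) ∂(stepLaw d) := by
      refine integral_mono (integrable_of_dependsOn (hdep (k + 1) _))
        (integrable_of_dependsOn (k := k + 1) ?_) fun s => ?_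
      · intro s t hst
        have hst' : ∀ i ∈ Set.Iio k, s i = t i :=
          fun i hi => hst i (by simp only [Set.mem_Iio] at hi ⊢; omega)
        simp only [show ((k : WithTop ℕ) < exitTime n x s) = ((k : WithTop ℕ) < exitTime n x t) from
          dependsOn_lt_exitTime n x k hst', dependsOn_walk x k hst', hst k (by simp)]
      · show (if ((k + 1 : ℕ) : WithTop ℕ) < exitTime n x s then potential n (walk x (k + 1) s)
          else 0) ≤ if (k : WithTop ℕ) < exitTime n x s
            then potential n (walk x k s + step (s k)) else 0
        by_cases hk : (k : WithTop ℕ) < exitTime n x s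
        · rw [if_pos hk, walk_succ]
          split_ifs
          · exact le_rfl
          · exact potential_nonneg ((isInterior_walk hx hk).add_step_mem _)
        · rw [if_neg hk, if_neg]
          rw [lt_exitTime_iff] at hk ⊢
          exact fun h => hk fun j hj => h j (by omega)
    rw [h] at h1
    refine h1.trans (le_of_eq ?_)
    have hA : MeasurableSet {s | (k : WithTop ℕ) < exitTime n x s} :=
      measurableSet_of_dependsOn (dependsOn_lt_exitTime n x k)
    rw [← integral_indicator_one hA, hb]
    simp only
    have hi1 : Integrable ({s | (k : WithTop ℕ) < exitTime n x s}.indicator (1 : (ℕ → Fin d × Bool) → ℝ))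
        (stepLaw d) := (integrable_const (1 : ℝ)).indicator hA
    rw [← integral_sub (integrable_of_dependsOn (hdep k (potential n))) hi1]
    refine integral_congr_ae (ae_of_all _ fun s => ?_)
    by_cases hk : (k : WithTop ℕ) < exitTime n x s
    · simp only [hk, if_true, sum_potential_add_step, Set.indicator_apply, Set.mem_ofPred_eq,
        Pi.one_apply]
    · simp [hk]
  have hsum : ∑ k ∈ Finset.range K, (stepLaw d).real {s | (k : WithTop ℕ) < exitTime n x s}
      ≤ b 0 - b K := by
    induction K with
    | zero => simp
    | succ K ih => rw [Finset.sum_range_succ]; linarith [hstep K]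
  have hb00 : b 0 ≤ d * (n : ℝ) ^ 2 := by
    have hbox := ((isInterior_iff n _).1 hx).1
    have h0 : ∀ s, (if ((0 : ℕ) : WithTop ℕ) < exitTime n x s then potential n (walk x 0 s)
        else 0) ≤ d * (n : ℝ) ^ 2 := by
      intro s
      split_ifs
      · simpa [walk] using potential_le hbox
      · positivity
    have := integral_mono (μ := stepLaw d) (integrable_of_dependsOn (hdep 0 (potential n)))
      (integrable_const _) h0
    rw [integral_const, probReal_univ, one_smul] at this
    exact this
  linarith [hb0 K]

end Walk

/-! ### Fourier analysis of the transition probabilities -/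

section Fourier

/-- The uniform distribution on `(-1/2, 1/2]`, the period of the Fourier variables. -/
noncomputable def unif : Measure ℝ := volume.restrict (Set.Ioc (-1 / 2) (1 / 2))

instance : IsProbabilityMeasure unif := by
  constructor
  rw [unif, Measure.restrict_apply_univ, Real.volume_Ioc]
  norm_num

lemma integral_unif {E : Type*} [NormedAddCommGroup E] [NormedSpace ℝ E] (f : ℝ → E) :
    ∫ x, f x ∂unif = ∫ x in (-1 / 2 : ℝ)..(1 / 2), f x := by
  rw [unif, intervalIntegral.integral_of_le (by norm_num)]

/-- The uniform distribution on the torus. -/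
noncomputable def torus (d : ℕ) : Measure (Fin d → ℝ) := Measure.pi fun _ => unif

instance (d : ℕ) : IsProbabilityMeasure (torus d) := by unfold torus; infer_instance

/-- The characteristic function of a step of the walk. -/
noncomputable def stepChar {d : ℕ} (x : Fin d → ℝ) : ℝ := (∑ i, Real.cos (2 * Real.pi * x i)) / d

/-- The phase of the character `z` at `x`. -/
noncomputable def phase {d : ℕ} (x : Fin d → ℝ) (z : Fin d → ℤ) : ℝ :=
  2 * Real.pi * ∑ i, x i * z i

variable {d : ℕ}

lemma continuous_stepChar : Continuous (stepChar (d := d)) := by unfold stepChar; fun_prop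

lemma continuous_phase (z : Fin d → ℤ) : Continuous (fun x => phase x z) := by
  unfold phase; fun_prop

lemma abs_stepChar_le (x : Fin d → ℝ) : |stepChar x| ≤ 1 := by
  rw [stepChar, abs_div, Nat.abs_cast]
  refine div_le_one_of_le₀ ?_ (by positivity)
  refine (Finset.abs_sum_le_sum_abs _ _).trans ?_
  simpa using Finset.sum_le_sum fun i (_ : i ∈ Finset.univ) => Real.abs_cos_le_one (2 * Real.pi * x i)

lemma integrable_of_continuous_of_le {f : (Fin d → ℝ) → ℝ} (hf : Continuous f) {C : ℝ}
    (hC : ∀ x, |f x| ≤ C) : Integrable f (torus d) :=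
  Integrable.of_bound hf.aestronglyMeasurable C (ae_of_all _ hC)

lemma integrable_stepChar_pow_mul_cos (k : ℕ) (z : Fin d → ℤ) :
    Integrable (fun x => stepChar x ^ k * Real.cos (phase x z)) (torus d) := by
  refine integrable_of_continuous_of_le (C := 1)
    ((continuous_stepChar.pow k).mul (Real.continuous_cos.comp (continuous_phase z))) fun x => ?_
  rw [abs_mul, abs_pow]
  exact mul_le_one₀ (pow_le_one₀ (abs_nonneg _) (abs_stepChar_le x)) (abs_nonneg _)
    (Real.abs_cos_le_one _)

lemma integral_exp_two_pi_mul (m : ℤ) :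
    ∫ x : ℝ, Complex.exp (2 * Real.pi * Complex.I * m * x) ∂unif = if m = 0 then 1 else 0 := by
  rw [integral_unif]
  split_ifs with hm
  · simp [hm]; norm_num
  · have hc : (2 * Real.pi * Complex.I * m : ℂ) ≠ 0 := by
      simp [hm, Complex.I_ne_zero, Real.pi_ne_zero]
    rw [integral_exp_mul_complex hc, div_eq_zero_iff]
    left
    rw [sub_eq_zero, Complex.exp_eq_exp_iff_exists_int]
    exact ⟨m, by push_cast; ring⟩

lemma integral_cos_phase (z : Fin d → ℤ) :
    ∫ x, Real.cos (phase x z) ∂(torus d) = if z = 0 then 1 else 0 := by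
  have h1 := integral_fintype_prod_eq_prod (𝕜 := ℂ) (μ := fun _ : Fin d => unif)
    (fun i (x : ℝ) => Complex.exp (2 * Real.pi * Complex.I * z i * x))
  simp_rw [integral_exp_two_pi_mul] at h1
  have h2 : ∀ x : Fin d → ℝ, ∏ i, Complex.exp (2 * Real.pi * Complex.I * z i * x i)
      = Complex.exp ((phase x z : ℝ) * Complex.I) := by
    intro x
    rw [← Complex.exp_sum]
    congr 1
    simp only [phase]
    push_cast
    rw [Finset.mul_sum, Finset.sum_mul]
    exact Finset.sum_congr rfl fun i _ => by ring
  simp_rw [h2] at h1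
  have hint : Integrable (fun x : Fin d → ℝ => Complex.exp ((phase x z : ℝ) * Complex.I))
      (torus d) := by
    have := continuous_phase z
    refine Integrable.of_bound (Continuous.aestronglyMeasurable (by fun_prop)) 1
      (ae_of_all _ fun x => ?_)
    rw [Complex.norm_exp_ofReal_mul_I]
  have h3 := integral_re hint
  simp only [RCLike.re_to_complex, Complex.exp_ofReal_mul_I_re] at h3
  rw [h3, torus, h1]
  by_cases hz : z = 0
  · simp [hz]
  · obtain ⟨i, hi⟩ := Function.ne_iff.1 hz
    rw [if_neg hz, Finset.prod_eq_zero (Finset.mem_univ i) (by simpa using hi)]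
    simp

/-- The characters are eigenfunctions of the transition operator of the walk. -/
lemma sum_cos_phase_sub_step [NeZero d] (x : Fin d → ℝ) (z : Fin d → ℤ) :
    (∑ e, Real.cos (phase x (z - step e))) / (2 * d) = stepChar x * Real.cos (phase x z) := by
  have key : ∀ e : Fin d × Bool, phase x (z - step e)
      = phase x z - (if e.2 then 1 else -1) * (2 * Real.pi * x e.1) := by
    rintro ⟨i, b⟩
    have : ∀ j, x j * ((z - step (i, b)) j : ℤ)
        = x j * z j - if j = i then (if b then (1 : ℝ) else -1) * x i else 0 := by
      intro j
      rcases eq_or_ne j i with rfl | hj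
      · cases b <;> simp [step] <;> ring
      · simp [step, hj]
    simp only [phase, this, Finset.sum_sub_distrib, Finset.sum_ite_eq', Finset.mem_univ, if_true]
    ring
  have hd : (d : ℝ) ≠ 0 := Nat.cast_ne_zero.2 (NeZero.ne d)
  simp_rw [key, Fintype.sum_prod_type]
  simp only [Fintype.sum_bool, if_true, Bool.false_eq_true, if_false]
  have : ∀ i : Fin d, Real.cos (phase x z - 1 * (2 * Real.pi * x i))
      + Real.cos (phase x z - -1 * (2 * Real.pi * x i))
      = 2 * Real.cos (phase x z) * Real.cos (2 * Real.pi * x i) := by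
    intro i
    rw [neg_one_mul, sub_neg_eq_add, one_mul, Real.cos_sub, Real.cos_add]; ring
  simp_rw [this, ← Finset.mul_sum, stepChar]
  field_simp

/-- Fourier inversion for the transition probabilities. -/
lemma heatKernel_eq_integral [NeZero d] (k : ℕ) (z : Fin d → ℤ) :
    heatKernel d k z = ∫ x, stepChar x ^ k * Real.cos (phase x z) ∂(torus d) := by
  induction k generalizing z with
  | zero => simp [heatKernel, integral_cos_phase]
  | succ k ih =>
    rw [heatKernel]
    simp_rw [ih]
    rw [← integral_finsetSum _ fun e _ => integrable_stepChar_pow_mul_cos k _, ← integral_div]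
    refine integral_congr_ae (ae_of_all _ fun x => ?_)
    simp only
    rw [← Finset.mul_sum, mul_div_assoc, sum_cos_phase_sub_step]
    ring

lemma phase_zero (x : Fin d → ℝ) : phase x 0 = 0 := by simp [phase]

/-- Two consecutive transition probabilities are together maximal at the origin. -/
lemma heatKernel_add_succ_le [NeZero d] (k : ℕ) (z : Fin d → ℤ) :
    heatKernel d (2 * k) z + heatKernel d (2 * k + 1) z
      ≤ heatKernel d (2 * k) 0 + heatKernel d (2 * k + 1) 0 := by
  simp_rw [heatKernel_eq_integral]
  rw [← integral_add (integrable_stepChar_pow_mul_cos _ _) (integrable_stepChar_pow_mul_cos _ _),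
    ← integral_add (integrable_stepChar_pow_mul_cos _ _) (integrable_stepChar_pow_mul_cos _ _)]
  refine integral_mono ((integrable_stepChar_pow_mul_cos _ _).add
    (integrable_stepChar_pow_mul_cos _ _)) ((integrable_stepChar_pow_mul_cos _ _).add
    (integrable_stepChar_pow_mul_cos _ _)) fun x => ?_
  simp only [phase_zero, Real.cos_zero, mul_one]
  have h1 := (abs_le.1 (abs_stepChar_le x)).1
  have h2 : 0 ≤ stepChar x ^ (2 * k) := by rw [pow_mul]; positivity
  have h3 := Real.cos_le_one (phase x z)
  have h4 : 0 ≤ stepChar x ^ (2 * k) * (1 + stepChar x) := mul_nonneg h2 (by linarith)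
  rw [pow_succ]
  nlinarith [mul_le_mul_of_nonneg_left h3 h4]

/-- The Laplace transform of `1 - cos` is dominated by that of the square of a standard
Gaussian variable: after `exp (-y) ≤ 1 / (1 + y)` the integral is explicit. -/
lemma integral_exp_neg_one_sub_cos_le {s : ℝ} (hs : 0 ≤ s) :
    ∫ x, Real.exp (-(s * (1 - Real.cos (2 * Real.pi * x)))) ∂unif ≤ (√(1 + 2 * s))⁻¹ := by
  set c := √(1 + 2 * s) with hc
  have hc0 : 0 < c := Real.sqrt_pos.2 (by linarith)
  have hc2 : c ^ 2 = 1 + 2 * s := Real.sq_sqrt (by linarith)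
  have hden : ∀ x : ℝ, 0 < 1 + s * (1 - Real.cos (2 * Real.pi * x)) := by
    intro x
    have := mul_nonneg hs (sub_nonneg.2 (Real.cos_le_one (2 * Real.pi * x)))
    linarith
  have hcont : Continuous fun x : ℝ => (1 + s * (1 - Real.cos (2 * Real.pi * x)))⁻¹ :=
    Continuous.inv₀ (by fun_prop) fun x => (hden x).ne'
  have h1 : ∫ x, Real.exp (-(s * (1 - Real.cos (2 * Real.pi * x)))) ∂unif
      ≤ ∫ x, (1 + s * (1 - Real.cos (2 * Real.pi * x)))⁻¹ ∂unif := by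
    rw [integral_unif, integral_unif]
    refine intervalIntegral.integral_mono_on (by norm_num)
      (Continuous.intervalIntegrable (by fun_prop) _ _) (hcont.intervalIntegrable _ _) fun x _ => ?_
    rw [Real.exp_neg]
    refine inv_anti₀ (hden x) ?_
    have := Real.add_one_le_exp (s * (1 - Real.cos (2 * Real.pi * x)))
    linarith
  refine h1.trans (le_of_eq ?_)
  rw [integral_unif]
  have hπ := Real.pi_pos
  have htop : Tendsto (fun x : ℝ => (Real.pi * c)⁻¹ * Real.arctan (c * Real.tan (Real.pi * x)))
      (𝓝[<] (1 / 2)) (𝓝 ((Real.pi * c)⁻¹ * (Real.pi / 2))) := by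
    refine Tendsto.const_mul _ ?_
    refine (tendsto_nhds_of_tendsto_nhdsWithin Real.tendsto_arctan_atTop).comp ?_
    refine Tendsto.const_mul_atTop hc0 (Real.tendsto_tan_pi_div_two.comp ?_)
    refine tendsto_nhdsWithin_iff.2 ⟨?_, ?_⟩
    · have : Tendsto (fun x : ℝ => Real.pi * x) (𝓝 (1 / 2)) (𝓝 (Real.pi * (1 / 2))) :=
        (continuous_const.mul continuous_id).tendsto _
      rw [mul_one_div] at this
      exact this.mono_left nhdsWithin_le_nhds
    · filter_upwards [self_mem_nhdsWithin] with x hx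
      simp only [Set.mem_Iio] at hx ⊢
      nlinarith
  have hbot : Tendsto (fun x : ℝ => (Real.pi * c)⁻¹ * Real.arctan (c * Real.tan (Real.pi * x)))
      (𝓝[>] (-1 / 2)) (𝓝 ((Real.pi * c)⁻¹ * (-(Real.pi / 2)))) := by
    refine Tendsto.const_mul _ ?_
    refine (tendsto_nhds_of_tendsto_nhdsWithin Real.tendsto_arctan_atBot).comp ?_
    refine Tendsto.const_mul_atBot hc0 (Real.tendsto_tan_neg_pi_div_two.comp ?_)
    refine tendsto_nhdsWithin_iff.2 ⟨?_, ?_⟩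
    · have : Tendsto (fun x : ℝ => Real.pi * x) (𝓝 (-1 / 2)) (𝓝 (Real.pi * (-1 / 2))) :=
        (continuous_const.mul continuous_id).tendsto _
      rw [show Real.pi * (-1 / 2) = -(Real.pi / 2) by ring] at this
      exact this.mono_left nhdsWithin_le_nhds
    · filter_upwards [self_mem_nhdsWithin] with x hx
      simp only [Set.mem_Ioi] at hx ⊢
      nlinarith
  rw [intervalIntegral.integral_eq_sub_of_hasDerivAt_of_tendsto (by norm_num) (fun x hx => ?_)
    (hcont.intervalIntegrable _ _) hbot htop]
  · field_simp; ring
  · have hcos : 0 < Real.cos (Real.pi * x) :=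
      Real.cos_pos_of_mem_Ioo ⟨by nlinarith [hx.1], by nlinarith [hx.2]⟩
    have hd1 : HasDerivAt (fun x : ℝ => Real.pi * x) Real.pi x := by
      simpa using (hasDerivAt_id x).const_mul Real.pi
    have hd2 := ((((Real.hasDerivAt_tan hcos.ne').comp x hd1).const_mul c).arctan).const_mul
      ((Real.pi * c)⁻¹)
    refine hd2.congr_deriv ?_
    have h2 : Real.cos (2 * Real.pi * x) = 2 * Real.cos (Real.pi * x) ^ 2 - 1 := by
      rw [← Real.cos_two_mul]; ring_nf
    simp only [Function.comp_apply]
    rw [Real.tan_eq_sin_div_cos]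
    have hsin := Real.sin_sq_add_cos_sq (Real.pi * x)
    have hS : Real.sin (Real.pi * x) ^ 2 = 1 - Real.cos (Real.pi * x) ^ 2 := by linarith
    have e1 : 1 + (c * (Real.sin (Real.pi * x) / Real.cos (Real.pi * x))) ^ 2
        = (1 + s * (1 - Real.cos (2 * Real.pi * x))) / Real.cos (Real.pi * x) ^ 2 := by
      rw [mul_pow, div_pow, hc2, hS, h2]
      field_simp
      ring
    rw [e1]
    have := (hden x).ne'
    field_simp

/-- A bound for the Laplace transform of `1 - stepChar` that is integrable for `d ≥ 3`. -/
lemma integral_exp_stepChar_le [NeZero d] {t : ℝ} (ht : 0 ≤ t) :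
    ∫ x, Real.exp (-(t * (1 - stepChar x))) ∂(torus d)
      ≤ (1 + 2 * (t / d)) ^ (-(d / 2 : ℝ)) := by
  have hd : (d : ℝ) ≠ 0 := Nat.cast_ne_zero.2 (NeZero.ne d)
  have h1 : ∀ x : Fin d → ℝ, Real.exp (-(t * (1 - stepChar x)))
      = ∏ i, Real.exp (-(t / d * (1 - Real.cos (2 * Real.pi * x i)))) := by
    intro x
    rw [← Real.exp_sum]
    congr 1
    rw [Finset.sum_neg_distrib, ← Finset.mul_sum, Finset.sum_sub_distrib, stepChar]
    simp
    field_simp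
  have h2 := integral_fintype_prod_eq_prod (𝕜 := ℝ) (μ := fun _ : Fin d => unif)
    (fun i (x : ℝ) => Real.exp (-(t / d * (1 - Real.cos (2 * Real.pi * x)))))
  simp_rw [h1]
  rw [torus, h2, Finset.prod_const, Finset.card_univ, Fintype.card_fin]
  have hb : 0 < 1 + 2 * (t / d) := by positivity
  have h3 : (1 + 2 * (t / d)) ^ (-(d / 2 : ℝ)) = ((√(1 + 2 * (t / d)))⁻¹) ^ d := by
    rw [Real.sqrt_eq_rpow, ← Real.rpow_neg hb.le, ← Real.rpow_natCast, ← Real.rpow_mul hb.le]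
    congr 1; ring
  rw [h3]
  exact pow_le_pow_left₀ (integral_nonneg fun x => (Real.exp_pos _).le)
    (integral_exp_neg_one_sub_cos_le (by positivity)) d

lemma lintegral_rpow_le (hd : 3 ≤ d) :
    ∫⁻ t in Set.Ioi (0 : ℝ), ENNReal.ofReal ((1 + 2 * (t / d)) ^ (-(d / 2 : ℝ)))
      = ENNReal.ofReal (d / (d - 2)) := by
  have hd3 : (3 : ℝ) ≤ d := by exact_mod_cast hd
  have hderiv : ∀ t ∈ Set.Ici (0 : ℝ), HasDerivAt
      (fun t : ℝ => -(d / (d - 2)) * (1 + 2 * (t / d)) ^ (1 - d / 2 : ℝ))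
      ((1 + 2 * (t / d)) ^ (-(d / 2 : ℝ))) t := by
    intro t ht
    have hb : 0 < 1 + 2 * (t / d) := by
      have : 0 ≤ t := ht
      positivity
    have hin : HasDerivAt (fun t : ℝ => 1 + 2 * (t / d)) (2 * (1 / d)) t :=
      (((hasDerivAt_id t).div_const (d : ℝ)).const_mul 2).const_add 1
    refine ((hin.rpow_const (p := (1 - d / 2 : ℝ)) (Or.inl hb.ne')).const_mul
      (-((d : ℝ) / (d - 2)))).congr_deriv ?_
    rw [show (1 - d / 2 : ℝ) - 1 = -(d / 2) by ring]
    have : (d : ℝ) - 2 ≠ 0 := by linarith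
    field_simp
    ring
  have hpos : ∀ t ∈ Set.Ioi (0 : ℝ), 0 ≤ (1 + 2 * (t / d)) ^ (-(d / 2 : ℝ)) := by
    intro t ht
    have : 0 < t := ht
    positivity
  have hlim : Tendsto (fun t : ℝ => -(d / (d - 2)) * (1 + 2 * (t / d)) ^ (1 - d / 2 : ℝ)) atTop
      (𝓝 (-(d / (d - 2)) * 0)) := by
    refine Tendsto.const_mul _ ?_
    rw [show (1 - d / 2 : ℝ) = -(d / 2 - 1) by ring]
    refine (tendsto_rpow_neg_atTop (by linarith)).comp ?_
    refine tendsto_atTop_add_const_left _ _ (Tendsto.const_mul_atTop two_pos ?_)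
    exact tendsto_id.atTop_div_const (by linarith)
  have h1 := integrableOn_Ioi_deriv_of_nonneg' hderiv hpos hlim
  have h2 := integral_Ioi_of_hasDerivAt_of_nonneg' hderiv hpos hlim
  rw [← ofReal_integral_eq_lintegral_ofReal h1 (ae_restrict_of_forall_mem measurableSet_Ioi hpos),
    h2]
  congr 1
  simp

lemma sum_range_two_mul_pow_nonneg {u : ℝ} (hu : -1 ≤ u) (K : ℕ) :
    0 ≤ ∑ k ∈ Finset.range (2 * K), u ^ k := by
  induction K with
  | zero => simp
  | succ K ih =>
    rw [mul_add_one, Finset.sum_range_succ, Finset.sum_range_succ, pow_succ]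
    have h2 : 0 ≤ u ^ (2 * K) := by rw [pow_mul]; positivity
    nlinarith

/-- The Green's function at the origin is the mean of `1 / (1 - stepChar)`, which is bounded by
writing this quotient as a Laplace integral. -/
lemma sum_heatKernel_zero_le (hd : 3 ≤ d) (K : ℕ) :
    ∑ k ∈ Finset.range (2 * K), heatKernel d k 0 ≤ d / (d - 2) := by
  have : NeZero d := ⟨by omega⟩
  have hd3 : (3 : ℝ) ≤ d := by exact_mod_cast hd
  have hint : ∀ k, Integrable (fun x => stepChar x ^ k) (torus d) := by
    intro k
    simpa [phase_zero] using integrable_stepChar_pow_mul_cos (d := d) k 0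
  have h1 : ∑ k ∈ Finset.range (2 * K), heatKernel d k 0
      = ∫ x, ∑ k ∈ Finset.range (2 * K), stepChar x ^ k ∂(torus d) := by
    rw [integral_finsetSum _ fun k _ => hint k]
    simp [heatKernel_eq_integral, phase_zero]
  have hpt : ∀ x : Fin d → ℝ, ENNReal.ofReal (∑ k ∈ Finset.range (2 * K), stepChar x ^ k)
      ≤ ∫⁻ t in Set.Ioi (0 : ℝ), ENNReal.ofReal (Real.exp (-(t * (1 - stepChar x)))) := by
    intro x
    have hu := abs_le.1 (abs_stepChar_le x)
    rcases eq_or_lt_of_le hu.2 with h | h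
    · simp [h]
    · have hl : 0 < 1 - stepChar x := by linarith
      have hI : IntegrableOn (fun t : ℝ => Real.exp (-(t * (1 - stepChar x)))) (Set.Ioi 0) := by
        have := exp_neg_integrableOn_Ioi 0 hl
        refine this.congr_fun (fun t _ => ?_) measurableSet_Ioi
        simp only; congr 1; ring
      rw [← ofReal_integral_eq_lintegral_ofReal hI (ae_of_all _ fun t => (Real.exp_pos _).le)]
      have hval : ∫ t in Set.Ioi (0 : ℝ), Real.exp (-(t * (1 - stepChar x)))
          = 1 / (1 - stepChar x) := by
        have := integral_exp_mul_Ioi (a := -(1 - stepChar x)) (by linarith) 0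
        rw [mul_zero, Real.exp_zero, neg_div_neg_eq] at this
        rw [← this]
        refine integral_congr_ae (ae_of_all _ fun t => ?_)
        simp only; congr 1; ring
      rw [hval]
      refine ENNReal.ofReal_le_ofReal ?_
      rw [geom_sum_eq h.ne, ← neg_div_neg_eq, neg_sub, neg_sub]
      refine div_le_div_of_nonneg_right ?_ hl.le
      have : 0 ≤ stepChar x ^ (2 * K) := by rw [pow_mul]; positivity
      linarith
  have hmeas : Measurable fun z : (Fin d → ℝ) × ℝ =>
      ENNReal.ofReal (Real.exp (-(z.2 * (1 - stepChar z.1)))) := by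
    have := continuous_stepChar (d := d)
    exact (Continuous.measurable (by fun_prop)).ennreal_ofReal
  rw [h1, ← ENNReal.ofReal_le_ofReal_iff (div_nonneg (by linarith) (by linarith)),
    ← lintegral_rpow_le hd]
  calc ENNReal.ofReal (∫ x, ∑ k ∈ Finset.range (2 * K), stepChar x ^ k ∂(torus d))
      = ∫⁻ x, ENNReal.ofReal (∑ k ∈ Finset.range (2 * K), stepChar x ^ k) ∂(torus d) :=
        ofReal_integral_eq_lintegral_ofReal (integrable_finsetSum _ fun k _ => hint k)
          (ae_of_all _ fun x => sum_range_two_mul_pow_nonneg (abs_le.1 (abs_stepChar_le x)).1 K)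
    _ ≤ ∫⁻ x, (∫⁻ t in Set.Ioi (0 : ℝ), ENNReal.ofReal (Real.exp (-(t * (1 - stepChar x)))))
          ∂(torus d) := lintegral_mono hpt
    _ = ∫⁻ t in Set.Ioi (0 : ℝ), ∫⁻ x, ENNReal.ofReal (Real.exp (-(t * (1 - stepChar x))))
          ∂(torus d) := lintegral_lintegral_swap hmeas.aemeasurable
    _ ≤ _ := by
      refine setLIntegral_mono' measurableSet_Ioi fun t ht => ?_
      have ht0 : (0 : ℝ) < t := ht
      rw [← ofReal_integral_eq_lintegral_ofReal]
      · exact ENNReal.ofReal_le_ofReal (integral_exp_stepChar_le ht0.le)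
      · have := continuous_stepChar (d := d)
        refine integrable_of_continuous_of_le (C := 1) (by fun_prop) fun x => ?_
        rw [abs_of_pos (Real.exp_pos _), Real.exp_le_one_iff, neg_nonpos]
        exact mul_nonneg ht0.le (sub_nonneg.2 (abs_le.1 (abs_stepChar_le x)).2)
      · exact ae_of_all _ fun x => (Real.exp_pos _).le

end Fourier

/-! ### Green's functions of the lattice and of the box -/

section Green

variable {d : ℕ}

/-- The Green's function of simple random walk on `ℤ^d`. -/
noncomputable def latticeGreen (d : ℕ) (z : Fin d → ℤ) : ℝ := ∑' k, heatKernel d k z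

lemma sum_range_heatKernel_zero_le (hd : 3 ≤ d) (K : ℕ) :
    ∑ k ∈ Finset.range K, heatKernel d k 0 ≤ d / (d - 2) :=
  (Finset.sum_le_sum_of_subset_of_nonneg (Finset.range_mono (by omega))
    fun k _ _ => heatKernel_nonneg k 0).trans (sum_heatKernel_zero_le hd K)

lemma summable_heatKernel_zero (hd : 3 ≤ d) : Summable fun k => heatKernel d k 0 :=
  summable_of_sum_range_le (fun k => heatKernel_nonneg k 0) (sum_range_heatKernel_zero_le hd)

lemma sum_range_heatKernel_le [NeZero d] (M K : ℕ) (z : Fin d → ℤ) :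
    ∑ k ∈ Finset.range (2 * K), heatKernel d (k + 2 * M) z
      ≤ ∑ k ∈ Finset.range (2 * K), heatKernel d (k + 2 * M) 0 := by
  induction K with
  | zero => simp
  | succ K ih =>
    rw [mul_add_one, Finset.sum_range_succ, Finset.sum_range_succ, Finset.sum_range_succ,
      Finset.sum_range_succ]
    have := heatKernel_add_succ_le (K + M) z
    rw [show 2 * (K + M) = 2 * K + 2 * M by ring,
      show 2 * K + 2 * M + 1 = 2 * K + 1 + 2 * M by ring] at this
    linarith

lemma sum_range_heatKernel_le_tsum (hd : 3 ≤ d) (M K : ℕ) (z : Fin d → ℤ) :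
    ∑ k ∈ Finset.range K, heatKernel d (k + 2 * M) z ≤ ∑' k, heatKernel d (k + 2 * M) 0 := by
  have : NeZero d := ⟨by omega⟩
  refine (Finset.sum_le_sum_of_subset_of_nonneg (Finset.range_mono (show K ≤ 2 * K by omega))
    fun k _ _ => heatKernel_nonneg _ z).trans ((sum_range_heatKernel_le M K z).trans ?_)
  exact ((summable_nat_add_iff (2 * M)).2 (summable_heatKernel_zero hd)).sum_le_tsum _
    fun k _ => heatKernel_nonneg _ _

lemma summable_heatKernel (hd : 3 ≤ d) (z : Fin d → ℤ) : Summable fun k => heatKernel d k z :=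
  summable_of_sum_range_le (fun k => heatKernel_nonneg k z)
    (fun K => sum_range_heatKernel_le_tsum hd 0 K z)

/-- The tails of the Green's function are maximal at the origin. -/
lemma tsum_heatKernel_add_le (hd : 3 ≤ d) (M : ℕ) (z : Fin d → ℤ) :
    ∑' k, heatKernel d (k + 2 * M) z ≤ ∑' k, heatKernel d (k + 2 * M) 0 :=
  Real.tsum_le_of_sum_range_le (fun _ => heatKernel_nonneg _ z)
    (fun K => sum_range_heatKernel_le_tsum hd M K z)

lemma greenZero_eq (hd : 3 ≤ d) : greenZero d = latticeGreen d 0 := by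
  have : NeZero d := ⟨by omega⟩
  have hm : ∀ k, MeasurableSet {s | walk (0 : Fin d → ℤ) k s = 0} := measurableSet_walk_eq 0 0
  rw [greenZero, lintegral_tsum fun k => (measurable_const.indicator (hm k)).aemeasurable]
  simp_rw [lintegral_indicator_const (hm _), one_mul]
  rw [ENNReal.tsum_toReal_eq fun k => measure_ne_top _ _]
  exact tsum_congr fun k => measureReal_walk_zero_eq k 0

lemma greenZero_le (hd : 3 ≤ d) : greenZero d ≤ d / (d - 2) := by
  rw [greenZero_eq hd]
  exact Real.tsum_le_of_sum_range_le (fun k => heatKernel_nonneg k 0)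
    (sum_range_heatKernel_zero_le hd)

lemma one_le_greenZero (hd : 3 ≤ d) : 1 ≤ greenZero d := by
  rw [greenZero_eq hd]
  have := (summable_heatKernel_zero hd).le_tsum 0 fun k _ => heatKernel_nonneg k 0
  simpa [heatKernel, latticeGreen] using this

/-- The first two terms of the Green's function are at most `0` and `1 / (2 * d)`, and the sum of
the others is maximal at the origin. -/
lemma latticeGreen_le (hd : 3 ≤ d) {z : Fin d → ℤ} (hz : z ≠ 0) :
    latticeGreen d z ≤ greenZero d - 1 + 1 / (2 * d) := by
  have h1 := (summable_heatKernel hd z).sum_add_tsum_nat_add 2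
  have h2 := (summable_heatKernel hd 0).sum_add_tsum_nat_add 2
  have h3 := tsum_heatKernel_add_le hd 1 z
  have h4 := heatKernel_one_le z
  have h5 := heatKernel_nonneg 1 (0 : Fin d → ℤ)
  have h6 : heatKernel d 0 z = 0 := by simp [heatKernel, hz]
  have h7 : heatKernel d 0 0 = 1 := by simp [heatKernel]
  rw [greenZero_eq hd, latticeGreen, latticeGreen, ← h1, ← h2]
  simp only [Finset.sum_range_succ, Finset.sum_range_zero, mul_one] at h3 ⊢
  linarith

/-- Only boundedly many points have a Green's function of at least `η`. -/
lemma exists_card_le_of_latticeGreen_ge (hd : 3 ≤ d) {η : ℝ} (hη : 0 < η) :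
    ∃ C : ℝ, ∀ S : Finset (Fin d → ℤ), (∀ z ∈ S, η ≤ latticeGreen d z) → (S.card : ℝ) ≤ C := by
  have : NeZero d := ⟨by omega⟩
  have ht : Tendsto (fun M : ℕ => ∑' k, heatKernel d (k + 2 * M) 0) atTop (𝓝 0) :=
    (tendsto_sum_nat_add fun k => heatKernel d k 0).comp
      (tendsto_id.const_mul_atTop' (by norm_num))
  obtain ⟨M, hM⟩ := (ht.eventually (gt_mem_nhds (half_pos hη))).exists
  refine ⟨2 * M / (η / 2), fun S hS => ?_⟩
  rw [le_div_iff₀ (half_pos hη)]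
  have h1 : ∀ z ∈ S, η / 2 ≤ ∑ k ∈ Finset.range (2 * M), heatKernel d k z := by
    intro z hz
    have h1 := (summable_heatKernel hd z).sum_add_tsum_nat_add (2 * M)
    have h2 := tsum_heatKernel_add_le hd M z
    have h3 := hS z hz
    rw [latticeGreen, ← h1] at h3
    linarith
  calc (S.card : ℝ) * (η / 2) = ∑ z ∈ S, η / 2 := by rw [Finset.sum_const, nsmul_eq_mul]
    _ ≤ ∑ z ∈ S, ∑ k ∈ Finset.range (2 * M), heatKernel d k z := Finset.sum_le_sum h1
    _ = ∑ k ∈ Finset.range (2 * M), ∑ z ∈ S, heatKernel d k z := Finset.sum_comm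
    _ ≤ ∑ k ∈ Finset.range (2 * M), (1 : ℝ) :=
      Finset.sum_le_sum fun k _ => sum_heatKernel_le_one k S
    _ = 2 * M := by simp

/-- The probability that the walk from `x` is in `y` at time `k`, before the exit from the box. -/
noncomputable def killedKernel (n : ℕ) (x y : Fin d → ℤ) (k : ℕ) : ℝ :=
  (stepLaw d).real {s | (k : WithTop ℕ) < exitTime n x s ∧ walk x k s = y}

lemma killedKernel_nonneg (n : ℕ) (x y : Fin d → ℤ) (k : ℕ) : 0 ≤ killedKernel n x y k :=
  measureReal_nonneg

lemma measurableSet_killed (n : ℕ) (x y : Fin d → ℤ) (k : ℕ) :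
    MeasurableSet {s | (k : WithTop ℕ) < exitTime n x s ∧ walk x k s = y} :=
  (measurableSet_of_dependsOn (dependsOn_lt_exitTime n x k)).inter (measurableSet_walk_eq x y k)

lemma killedKernel_le [NeZero d] (n : ℕ) (x y : Fin d → ℤ) (k : ℕ) :
    killedKernel n x y k ≤ heatKernel d k (y - x) := by
  rw [← measureReal_walk_eq]
  exact measureReal_mono fun s hs => hs.2

lemma summable_killedKernel (hd : 3 ≤ d) (n : ℕ) (x y : Fin d → ℤ) :
    Summable (killedKernel n x y) :=
  have : NeZero d := ⟨by omega⟩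
  Summable.of_nonneg_of_le (killedKernel_nonneg n x y) (killedKernel_le n x y)
    (summable_heatKernel hd _)

lemma boxGreen_eq [NeZero d] (n : ℕ) (x y : Fin d → ℤ) :
    boxGreen n x y = ∑' k, killedKernel n x y k := by
  have hm := measurableSet_killed n x y
  rw [boxGreen, lintegral_tsum fun k => (measurable_const.indicator (hm k)).aemeasurable]
  simp_rw [lintegral_indicator_const (hm _), one_mul]
  rw [ENNReal.tsum_toReal_eq fun k => measure_ne_top _ _]
  rfl

lemma boxGreen_nonneg (n : ℕ) (x y : Fin d → ℤ) : 0 ≤ boxGreen n x y := ENNReal.toReal_nonneg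

lemma boxGreen_le_latticeGreen (hd : 3 ≤ d) (n : ℕ) (x y : Fin d → ℤ) :
    boxGreen n x y ≤ latticeGreen d (y - x) := by
  have : NeZero d := ⟨by omega⟩
  rw [boxGreen_eq]
  exact (summable_killedKernel hd n x y).tsum_le_tsum (killedKernel_le n x y)
    (summable_heatKernel hd _)

lemma boxGreen_self_le (hd : 3 ≤ d) (n : ℕ) (x : Fin d → ℤ) : boxGreen n x x ≤ greenZero d := by
  rw [greenZero_eq hd]
  simpa using boxGreen_le_latticeGreen hd n x x

lemma one_le_boxGreen_self (hd : 3 ≤ d) {n : ℕ} {x : Fin d → ℤ} (hx : IsInterior n x) :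
    1 ≤ boxGreen n x x := by
  have : NeZero d := ⟨by omega⟩
  rw [boxGreen_eq]
  refine le_trans (le_of_eq ?_) ((summable_killedKernel hd n x x).le_tsum 0
    fun k _ => killedKernel_nonneg n x x k)
  have : {s | ((0 : ℕ) : WithTop ℕ) < exitTime n x s ∧ walk x 0 s = x} = Set.univ := by
    refine Set.eq_univ_of_forall fun s => ⟨?_, by simp [walk]⟩
    rw [lt_exitTime_iff]
    intro j hj
    obtain rfl : j = 0 := by omega
    simpa [walk] using ((isInterior_iff n x).1 hx).2
  rw [killedKernel, this, probReal_univ]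

/-- The expected exit time bounds the sum of the Green's function. -/
lemma sum_boxGreen_le (hd : 3 ≤ d) {n : ℕ} {x : Fin d → ℤ} (hx : IsInterior n x)
    (S : Finset (Fin d → ℤ)) : ∑ y ∈ S, boxGreen n x y ≤ d * (n : ℝ) ^ 2 := by
  have : NeZero d := ⟨by omega⟩
  simp_rw [boxGreen_eq]
  rw [← Summable.tsum_finsetSum fun y _ => summable_killedKernel hd n x y]
  refine Real.tsum_le_of_sum_range_le
    (fun k => Finset.sum_nonneg fun y _ => killedKernel_nonneg n x y k) fun K => ?_
  refine (Finset.sum_le_sum fun k _ => ?_).trans (sum_measureReal_lt_exitTime_le hx K)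
  simp only [killedKernel]
  rw [← measureReal_biUnion_finset]
  · refine measureReal_mono fun s hs => ?_
    simp only [Set.mem_iUnion] at hs
    obtain ⟨y, _, hs⟩ := hs
    exact hs.1
  · intro y _ w _ hyw
    exact Set.disjoint_left.2 fun s hs hs' => hyw (hs.2.symm.trans hs'.2)
  · intro y _; exact measurableSet_killed n x y k

end Green

/-! ### The exceedances of the Gaussian free field -/

section TotalVariation

variable {d n : ℕ} {Ω : Type*} [MeasurableSpace Ω] {P : Measure Ω} {φ : box d n → Ω → ℝ}

lemma IsDGFF.cov_nonneg (hφ : IsDGFF d n φ P) (x y : box d n) : 0 ≤ cov[φ x, φ y; P] := by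
  rw [hφ.cov_eq]; exact boxGreen_nonneg _ _ _

/-- The total variation distance is at most the sum of the covariances of the exceedances. -/
theorem tvDist_le [IsProbabilityMeasure P] (hφ : IsDGFF d n φ P) (δ α : ℝ) :
    tvDist (P.map (highPoints δ α φ)) (bernoulliSetLaw (highProb δ α φ P))
      ≤ ∑ k : bulk d n δ, ∑ j ∈ Finset.univ.erase k,
        2 * pairCov P (level d n α) (φ j) (φ k) := by
  classical
  set L := level d n α with hLdef
  set ψ : bulk d n δ → Ω → ℝ := fun i => φ i
  have hG : HasGaussianLaw (fun ω i => ψ i ω) P := hφ.isGaussianProcess.hasGaussianLaw _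
  have hψ : ∀ i, AEMeasurable (ψ i) P := fun i => (hG.eval i).aemeasurable
  set X : Ω → bulk d n δ → Bool := fun ω => exceed L (fun i => ψ i ω)
  have hX : AEMeasurable X P := (measurable_exceed L).comp_aemeasurable (aemeasurable_pi_lambda _ hψ)
  let toSet : (bulk d n δ → Bool) → Set (bulk d n δ) := fun Z => {i | Z i = true}
  have htoSet : Measurable toSet := measurable_of_finite _
  set m := P.map X
  have : IsProbabilityMeasure m := Measure.isProbabilityMeasure_map hX
  have hlaw : P.map (highPoints δ α φ) = m.map toSet := by
    rw [AEMeasurable.map_map_of_aemeasurable htoSet.aemeasurable hX]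
    congr 1
    ext ω i
    simp [highPoints, toSet, X, exceed, ψ, hLdef]
  have hq : ∀ k, (highProb δ α φ P k : ℝ) = m.real {b | b k = true} := by
    intro k
    rw [map_measureReal_apply_of_aemeasurable hX (Set.toFinite _).measurableSet]
    show P.real {ω | level d n α ≤ φ k ω} = _
    congr 1
    ext ω
    simp [X, exceed, ψ, hLdef]
  have hmain := abs_integral_sub_integral_pi_le m (highProb δ α φ P) hq
    (fun k => ∑ j ∈ Finset.univ.erase k, 2 * pairCov P L (ψ j) (ψ k))
    (fun k D hD hD1 => abs_coordCov_le hG L k (fun j => hφ.cov_nonneg _ _) hD hD1)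
  have : Nonempty {A : Set (Set (bulk d n δ)) // MeasurableSet A} := ⟨⟨∅, MeasurableSet.empty⟩⟩
  refine ciSup_le fun A => ?_
  have hS : MeasurableSet (toSet ⁻¹' A.1) := htoSet A.2
  rw [hlaw, map_measureReal_apply htoSet A.2, bernoulliSetLaw, map_measureReal_apply htoSet A.2,
    ← integral_indicator_one hS, ← integral_indicator_one hS]
  refine hmain _ fun b => ?_
  by_cases hb : b ∈ toSet ⁻¹' A.1 <;> simp [hb]

end TotalVariation

section Exponents

variable {d : ℕ} {α : ℝ}

/-- An upper bound for the Green's function of `ℤ^d` between two distinct points. -/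
noncomputable def pairGreen (d : ℕ) : ℝ := greenZero d - 1 + 1 / (2 * d)

lemma four_mul_lt (hd : 3 ≤ d) (hα : 3 / 4 * ((d : ℝ) - 2 / 3) / ((d : ℝ) - 1) < α) :
    3 * (d : ℝ) - 2 < 4 * α * (d - 1) := by
  have hd3 : (3 : ℝ) ≤ d := by exact_mod_cast hd
  rw [div_lt_iff₀ (by linarith)] at hα
  linarith

lemma three_quarters_lt (hd : 3 ≤ d) (hα : 3 / 4 * ((d : ℝ) - 2 / 3) / ((d : ℝ) - 1) < α) :
    3 / 4 < α := by
  have hd3 : (3 : ℝ) ≤ d := by exact_mod_cast hd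
  have := four_mul_lt hd hα
  by_contra h
  nlinarith

/-- The threshold enters here: it makes the sum of the covariances of distant points small. -/
lemma add_two_lt (hd : 3 ≤ d) (hα : 3 / 4 * ((d : ℝ) - 2 / 3) / ((d : ℝ) - 1) < α) :
    (d : ℝ) + 2 < 2 * α * d := by
  have hd3 : (3 : ℝ) ≤ d := by exact_mod_cast hd
  have h := four_mul_lt hd hα
  by_contra hc
  have h1 : 2 * α * d * (2 * (d - 1)) ≤ (d + 2) * (2 * ((d : ℝ) - 1)) :=
    mul_le_mul_of_nonneg_right (not_lt.1 hc) (by linarith)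
  have h2 := mul_lt_mul_of_pos_right h (show (0 : ℝ) < d by linarith)
  -- `d * (3 * d - 2) - 2 * (d - 1) * (d + 2) = (d - 2) ^ 2`
  nlinarith [sq_nonneg ((d : ℝ) - 2)]

/-- The threshold also excludes pairs of high points at a bounded distance. The only information
on the walk that enters is the bound `greenZero d ≤ d / (d - 2)`. -/
lemma greenZero_add_pairGreen_lt (hd : 3 ≤ d)
    (hα : 3 / 4 * ((d : ℝ) - 2 / 3) / ((d : ℝ) - 1) < α) :
    greenZero d + pairGreen d < 2 * α * greenZero d := by
  have hd3 : (3 : ℝ) ≤ d := by exact_mod_cast hd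
  have h := four_mul_lt hd hα
  have hG := greenZero_le hd
  have hG1 := one_le_greenZero hd
  rw [le_div_iff₀ (by linarith)] at hG
  have hinv : 1 / (2 * (d : ℝ)) ≤ 1 / 6 := by
    apply one_div_le_one_div_of_le <;> linarith
  suffices 2 * greenZero d * (1 - α) < 1 - 1 / (2 * (d : ℝ)) by
    rw [pairGreen]; linarith
  rcases le_or_gt 1 α with h1 | h1
  · have : 0 ≤ greenZero d * (α - 1) := mul_nonneg (by linarith) (by linarith)
    linarith
  · have e1 : 2 * greenZero d * (1 - α) * (4 * (d - 1)) < 2 * d := by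
      have : 4 * (1 - α) * (d - 1) < (d : ℝ) - 2 := by linarith
      nlinarith
    have e2 : 1 - 1 / (2 * (d : ℝ)) = (2 * d - 1) / (2 * d) := by field_simp
    rw [e2, lt_div_iff₀ (by linarith)]
    nlinarith

end Exponents

section Asymptotics

variable {d n : ℕ} {α : ℝ}

lemma level_nonneg : 0 ≤ level d n α := Real.sqrt_nonneg _

lemma level_sq (hd : 3 ≤ d) (hα : 0 < α) :
    level d n α ^ 2 = 2 * α * d * greenZero d * Real.log n := by
  have := one_le_greenZero hd
  refine Real.sq_sqrt (mul_nonneg ?_ (Real.log_natCast_nonneg n))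
  positivity

/-- Gaussian tails at multiples of the level, as powers of `n`. -/
lemma exp_level (hd : 3 ≤ d) (hα : 0 < α) (hn : 1 ≤ n) (c : ℝ) {V : ℝ} (hV : 0 < V) :
    Real.exp (-(c * level d n α) ^ 2 / (2 * V))
      = (n : ℝ) ^ (-(c ^ 2 * (α * d * greenZero d / V))) := by
  have hn0 : (0 : ℝ) < n := by exact_mod_cast hn
  rw [Real.rpow_def_of_pos hn0, mul_pow, level_sq hd hα]
  congr 1
  field_simp

variable {Ω : Type*} [MeasurableSpace Ω] {P : Measure Ω} {φ : box d n → Ω → ℝ}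

lemma IsDGFF.variance_eq [IsProbabilityMeasure P] (hφ : IsDGFF d n φ P) (x : box d n) :
    Var[φ x; P] = boxGreen n (x : Fin d → ℤ) (x : Fin d → ℤ) := by
  rw [← hφ.cov_eq, covariance_self (hφ.isGaussianProcess.aemeasurable x)]

/-- The covariance of the exceedances at two points of the box: the last term is only needed for
points so close that their Green's function is at least `η`. -/
lemma IsDGFF.pairCov_le [IsProbabilityMeasure P] (hφ : IsDGFF d n φ P) (hd : 3 ≤ d) (hα : 0 < α)
    (hn : 1 ≤ n) {η : ℝ} (hη : η ≤ 1 / 2) {x y : box d n} (hxy : x ≠ y)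
    (hx : IsInterior n (x : Fin d → ℤ)) (hy : IsInterior n (y : Fin d → ℤ)) :
    pairCov P (level d n α) (φ y) (φ x)
      ≤ 2 * (n : ℝ) ^ (-(4 * α * d))
        + 4 * level d n α * (n : ℝ) ^ (-(α * d * (2 - 4 * η)))
          * boxGreen n (x : Fin d → ℤ) (y : Fin d → ℤ)
        + if η ≤ boxGreen n (x : Fin d → ℤ) (y : Fin d → ℤ) then
            (n : ℝ) ^ (-(2 * α * d * greenZero d / (greenZero d + pairGreen d))) else 0 := by
  have hG1 := one_le_greenZero hd
  have hd3 : (3 : ℝ) ≤ d := by exact_mod_cast hd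
  have hn1 : (1 : ℝ) ≤ n := by exact_mod_cast hn
  have hL : 0 ≤ level d n α := level_nonneg
  set g := boxGreen n (x : Fin d → ℤ) (y : Fin d → ℤ) with hg
  have hg0 : 0 ≤ g := boxGreen_nonneg _ _ _
  have hcov : cov[φ y, φ x; P] = g := by rw [covariance_comm, hφ.cov_eq]
  have hVx := hφ.variance_eq x
  have hVy := hφ.variance_eq y
  have hx1 := one_le_boxGreen_self hd hx
  have hy1 := one_le_boxGreen_self hd hy
  have hxG := boxGreen_self_le hd n (x : Fin d → ℤ)
  have hyG := boxGreen_self_le hd n (y : Fin d → ℤ)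
  have hpow : ∀ e : ℝ, 0 ≤ (n : ℝ) ^ e := fun e => Real.rpow_nonneg (by linarith) e
  by_cases hgη : η ≤ g
  · rw [if_pos hgη]
    have hne : (y : Fin d → ℤ) - x ≠ 0 := sub_ne_zero.2 fun h => hxy (Subtype.ext h.symm)
    have hgp : g ≤ pairGreen d :=
      (boxGreen_le_latticeGreen hd n _ _).trans (latticeGreen_le hd hne)
    have h1 := pairCov_le_of_variance_add_le (L := level d n α)
      (V := 2 * (greenZero d + pairGreen d))
      (hφ.isGaussianProcess.hasGaussianLaw_prodMk (s := y) (t := x)) (hφ.mean_zero y)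
      (hφ.mean_zero x) hL (by rw [hVx, hVy, hcov]; linarith)
    rw [exp_level hd hα hn 2 (by linarith)] at h1
    have e : (2 : ℝ) ^ 2 * (α * d * greenZero d / (2 * (greenZero d + pairGreen d)))
        = 2 * α * d * greenZero d / (greenZero d + pairGreen d) := by
      have : greenZero d + pairGreen d ≠ 0 := by linarith
      field_simp
    rw [e] at h1
    have := hpow (-(4 * α * d))
    have := mul_nonneg (mul_nonneg (mul_nonneg zero_le_four hL) (hpow (-(α * d * (2 - 4 * η))))) hg0
    linarith
  · rw [if_neg hgη, add_zero]
    have hgη' : g ≤ η := (not_le.1 hgη).le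
    have hβ0 : 0 ≤ regCoeff P (φ y) (φ x) := regCoeff_nonneg (hcov ▸ hg0)
    have hβg : regCoeff P (φ y) (φ x) ≤ g := by
      rw [regCoeff, hcov, hVx]
      exact div_le_self hg0 hx1
    set β := regCoeff P (φ y) (φ x)
    have hββ : β * g ≤ 1 / 2 * (1 / 2) :=
      mul_le_mul (by linarith) (by linarith) hg0 (by norm_num)
    have h1 := pairCov_le_of_regCoeff_le (L := level d n α) (G := greenZero d)
      (hφ.isGaussianProcess.hasGaussianLaw_prodMk (s := x) (t := y)) (hφ.mean_zero x)
      (hφ.mean_zero y) hL (by rw [hVx]; exact hxG) (by rw [hVy]; exact hyG) (hcov ▸ hg0)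
      (by linarith) (by rw [hVy, hcov]; linarith)
    refine h1.trans (add_le_add (le_of_eq ?_) ?_)
    · rw [exp_level hd hα hn 2 (by linarith)]
      congr 3
      field_simp
      ring
    · have e1 : Real.exp (-(level d n α) ^ 2 / (2 * greenZero d)) = (n : ℝ) ^ (-(α * d)) := by
        have := exp_level (d := d) (α := α) hd hα hn 1 (V := greenZero d) (by linarith)
        rw [one_mul] at this
        rw [this]
        congr 2
        field_simp
      have e2 : Real.exp (-(level d n α - 2 * β * level d n α) ^ 2 / (2 * greenZero d))
          ≤ (n : ℝ) ^ (-(α * d * (1 - 4 * η))) := by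
        have := exp_level (d := d) (α := α) hd hα hn (1 - 2 * β) (V := greenZero d) (by linarith)
        rw [show (1 - 2 * β) * level d n α = level d n α - 2 * β * level d n α by ring] at this
        rw [this]
        refine Real.rpow_le_rpow_of_exponent_le hn1 (neg_le_neg ?_)
        rw [mul_div_cancel_right₀ _ (by linarith : greenZero d ≠ 0), mul_comm (_ ^ 2)]
        refine mul_le_mul_of_nonneg_left ?_ (by positivity)
        nlinarith
      rw [e1]
      calc (n : ℝ) ^ (-(α * d)) * (4 * β * level d n α
            * Real.exp (-(level d n α - 2 * β * level d n α) ^ 2 / (2 * greenZero d)))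
          ≤ (n : ℝ) ^ (-(α * d)) * (4 * g * level d n α * (n : ℝ) ^ (-(α * d * (1 - 4 * η)))) := by
            gcongr
        _ = 4 * level d n α * ((n : ℝ) ^ (-(α * d)) * (n : ℝ) ^ (-(α * d * (1 - 4 * η)))) * g := by
            ring
        _ = _ := by
            rw [← Real.rpow_add (by linarith)]
            congr 3
            ring

/-- For `n ≥ 1` the bulk does not meet the boundary, so that the field is not degenerate there. -/
lemma isInterior_of_mem_bulk {δ : ℝ} (hδ0 : 0 < δ) (hn : 1 ≤ n) (x : bulk d n δ) :
    IsInterior n ((x : box d n) : Fin d → ℤ) := by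
  have hn1 : (1 : ℝ) ≤ n := by exact_mod_cast hn
  have hx := (Finset.mem_filter.1 x.2).2
  intro i
  have h1 : (0 : ℝ) < ((x : box d n) : Fin d → ℤ) i := by
    have := mul_pos hδ0 (show (0 : ℝ) < n by linarith)
    linarith [(hx i).1]
  have h2 : (((x : box d n) : Fin d → ℤ) i : ℝ) < n := by
    have := mul_pos hδ0 (show (0 : ℝ) < n by linarith)
    linarith [(hx i).2]
  exact ⟨by exact_mod_cast h1, by exact_mod_cast h2⟩

lemma card_bulk_le (δ : ℝ) (hn : 1 ≤ n) : ((bulk d n δ).card : ℝ) ≤ 2 ^ d * (n : ℝ) ^ (d : ℝ) := by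
  have h1 : (bulk d n δ).card ≤ (n + 1) ^ d := by
    refine (Finset.card_le_univ _).trans (le_of_eq ?_)
    rw [Fintype.card_coe, Pi.card_Icc]
    simp
  rw [Real.rpow_natCast, ← mul_pow]
  have hn1 : (1 : ℝ) ≤ n := by exact_mod_cast hn
  calc ((bulk d n δ).card : ℝ) ≤ ((n : ℝ) + 1) ^ d := by exact_mod_cast h1
    _ ≤ (2 * n) ^ d := pow_le_pow_left₀ (by linarith) (by linarith) d

/-- The sum of the covariances of all pairs of exceedances in the bulk. -/
lemma IsDGFF.sum_pairCov_le [IsProbabilityMeasure P] (hφ : IsDGFF d n φ P) (hd : 3 ≤ d)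
    (hα : 0 < α) (hn : 1 ≤ n) {η C : ℝ} (hη : η ≤ 1 / 2)
    (hC : ∀ S : Finset (Fin d → ℤ), (∀ z ∈ S, η ≤ latticeGreen d z) → (S.card : ℝ) ≤ C)
    {δ : ℝ} (hδ0 : 0 < δ) :
    ∑ k : bulk d n δ, ∑ j ∈ Finset.univ.erase k, 2 * pairCov P (level d n α) (φ j) (φ k)
      ≤ 2 * (2 ^ d * (n : ℝ) ^ (d : ℝ)) * (2 * (2 ^ d * (n : ℝ) ^ (d : ℝ)) * (n : ℝ) ^ (-(4 * α * d))
        + 4 * level d n α * (n : ℝ) ^ (-(α * d * (2 - 4 * η))) * (d * (n : ℝ) ^ 2)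
        + C * (n : ℝ) ^ (-(2 * α * d * greenZero d / (greenZero d + pairGreen d)))) := by
  have hn1 : (1 : ℝ) ≤ n := by exact_mod_cast hn
  have hcard := card_bulk_le (d := d) (n := n) δ hn
  have hpow : ∀ e : ℝ, 0 ≤ (n : ℝ) ^ e := fun e => Real.rpow_nonneg (by linarith) e
  have hL : 0 ≤ level d n α := level_nonneg
  have hC0 : 0 ≤ C := by simpa using hC ∅ (by simp)
  set p4 := (n : ℝ) ^ (-(4 * α * d))
  set p2 := (n : ℝ) ^ (-(α * d * (2 - 4 * η)))
  set p3 := (n : ℝ) ^ (-(2 * α * d * greenZero d / (greenZero d + pairGreen d)))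
  set N := (2 : ℝ) ^ d * (n : ℝ) ^ (d : ℝ)
  have hN : 0 ≤ N := mul_nonneg (by positivity) (hpow _)
  let pt : bulk d n δ → Fin d → ℤ := fun x => ((x : box d n) : Fin d → ℤ)
  have hpt : Function.Injective pt := Subtype.val_injective.comp Subtype.val_injective
  have hrow : ∀ k : bulk d n δ,
      ∑ j ∈ Finset.univ.erase k, 2 * pairCov P (level d n α) (φ j) (φ k)
        ≤ 2 * (2 * N * p4 + 4 * level d n α * p2 * (d * (n : ℝ) ^ 2) + C * p3) := by
    intro k
    rw [← Finset.mul_sum]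
    refine mul_le_mul_of_nonneg_left ?_ zero_le_two
    have hpair : ∀ j ∈ Finset.univ.erase k, pairCov P (level d n α) (φ j) (φ k)
        ≤ 2 * p4 + 4 * level d n α * p2 * boxGreen n (pt k) (pt j)
          + if η ≤ boxGreen n (pt k) (pt j) then p3 else 0 := by
      intro j hj
      refine hφ.pairCov_le hd hα hn hη (fun h => ?_) (isInterior_of_mem_bulk hδ0 hn k)
        (isInterior_of_mem_bulk hδ0 hn j)
      exact (Finset.ne_of_mem_erase hj) (Subtype.ext h.symm)
    refine (Finset.sum_le_sum hpair).trans ?_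
    rw [Finset.sum_add_distrib, Finset.sum_add_distrib]
    refine add_le_add (add_le_add ?_ ?_) ?_
    · have : ((Finset.univ.erase k).card : ℝ) ≤ N := by
        refine le_trans ?_ hcard
        exact_mod_cast (Finset.card_le_univ _).trans (Fintype.card_coe _).le
      have hp := hpow (-(4 * α * d))
      rw [Finset.sum_const, nsmul_eq_mul]
      calc ((Finset.univ.erase k).card : ℝ) * (2 * p4) ≤ N * (2 * p4) := by gcongr
        _ = 2 * N * p4 := by ring
    · rw [← Finset.mul_sum]
      refine mul_le_mul_of_nonneg_left ?_ (mul_nonneg (by positivity) (hpow _))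
      rw [← Finset.sum_image (f := fun y => boxGreen n (pt k) y) (g := pt) hpt.injOn]
      exact sum_boxGreen_le hd (isInterior_of_mem_bulk hδ0 hn k) _
    · rw [← Finset.sum_filter, Finset.sum_const, nsmul_eq_mul]
      refine mul_le_mul_of_nonneg_right ?_ (hpow _)
      have hinj : Function.Injective fun j : bulk d n δ => pt j - pt k :=
        fun a b h => hpt (sub_left_injective h)
      rw [← Finset.card_image_of_injective _ hinj]
      refine hC _ fun z hz => ?_
      obtain ⟨j, hj, rfl⟩ := Finset.mem_image.1 hz
      exact (Finset.mem_filter.1 hj).2.trans (boxGreen_le_latticeGreen hd n _ _)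
  refine (Finset.sum_le_sum fun k _ => hrow k).trans ?_
  rw [Finset.sum_const, nsmul_eq_mul]
  have hB : 0 ≤ 2 * N * p4 + 4 * level d n α * p2 * (d * (n : ℝ) ^ 2) + C * p3 := by
    have h1 := hpow (-(4 * α * d))
    have h2 := hpow (-(α * d * (2 - 4 * η)))
    have h3 := hpow (-(2 * α * d * greenZero d / (greenZero d + pairGreen d)))
    positivity
  have : ((Finset.univ : Finset (bulk d n δ)).card : ℝ) ≤ N := by simpa using hcard
  calc _ ≤ N * (2 * (2 * N * p4 + 4 * level d n α * p2 * (d * (n : ℝ) ^ 2) + C * p3)) := by gcongr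
    _ = _ := by ring

lemma tendsto_natCast_rpow {e : ℝ} (he : e < 0) :
    Tendsto (fun n : ℕ => (n : ℝ) ^ e) atTop (𝓝 0) := by
  have := (tendsto_rpow_neg_atTop (neg_pos.2 he)).comp tendsto_natCast_atTop_atTop
  simpa [Function.comp_def] using this

lemma tendsto_level_mul_rpow (hd : 3 ≤ d) (hα : 0 < α) {e : ℝ} (he : e < 0) :
    Tendsto (fun n : ℕ => level d n α * (n : ℝ) ^ e) atTop (𝓝 0) := by
  have hlog : Tendsto (fun n : ℕ => Real.log n * (n : ℝ) ^ e) atTop (𝓝 0) := by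
    have h := (isLittleO_log_rpow_atTop (neg_pos.2 he)).tendsto_div_nhds_zero.comp
      tendsto_natCast_atTop_atTop
    refine h.congr fun n => ?_
    simp only [Function.comp_apply]
    rw [Real.rpow_neg (Nat.cast_nonneg n), div_inv_eq_mul]
  have hup := (tendsto_natCast_rpow he).add (hlog.const_mul (2 * α * d * greenZero d))
  rw [mul_zero, add_zero] at hup
  refine squeeze_zero (fun n => mul_nonneg level_nonneg (Real.rpow_nonneg (Nat.cast_nonneg n) e))
    (fun n => ?_) hup
  have hsq := level_sq (n := n) hd hα
  have hle : level d n α ≤ 1 + 2 * α * d * greenZero d * Real.log n := by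
    rw [← hsq]; nlinarith [sq_nonneg (level d n α - 1)]
  calc level d n α * (n : ℝ) ^ e ≤ (1 + 2 * α * d * greenZero d * Real.log n) * (n : ℝ) ^ e := by
        gcongr
    _ = _ := by ring

lemma tendsto_bound (hd : 3 ≤ d) (hα : 0 < α) (C : ℝ) {a b c : ℝ} (ha : 2 * (d : ℝ) + a < 0)
    (hb : (d : ℝ) + 2 + b < 0) (hc : (d : ℝ) + c < 0) :
    Tendsto (fun n : ℕ => 2 * (2 ^ d * (n : ℝ) ^ (d : ℝ))
      * (2 * (2 ^ d * (n : ℝ) ^ (d : ℝ)) * (n : ℝ) ^ a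
        + 4 * level d n α * (n : ℝ) ^ b * (d * (n : ℝ) ^ 2) + C * (n : ℝ) ^ c)) atTop (𝓝 0) := by
  have h1 := (tendsto_natCast_rpow ha).const_mul (4 * (2 : ℝ) ^ d * 2 ^ d)
  have h2 := (tendsto_level_mul_rpow (α := α) hd hα hb).const_mul (8 * (2 : ℝ) ^ d * d)
  have h3 := (tendsto_natCast_rpow hc).const_mul (2 * (2 : ℝ) ^ d * C)
  have h := (h1.add h2).add h3
  simp only [mul_zero, add_zero] at h
  refine h.congr' ?_
  filter_upwards [eventually_ge_atTop 1] with n hn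
  have hn0 : (0 : ℝ) < n := by exact_mod_cast hn
  have e1 : (n : ℝ) ^ (2 * (d : ℝ) + a) = (n : ℝ) ^ (d : ℝ) * (n : ℝ) ^ (d : ℝ) * (n : ℝ) ^ a := by
    rw [← Real.rpow_add hn0, ← Real.rpow_add hn0]; ring_nf
  have e2 : (n : ℝ) ^ ((d : ℝ) + 2 + b) = (n : ℝ) ^ (d : ℝ) * (n : ℝ) ^ 2 * (n : ℝ) ^ b := by
    rw [Real.rpow_add hn0, Real.rpow_add hn0, Real.rpow_two]
  have e3 : (n : ℝ) ^ ((d : ℝ) + c) = (n : ℝ) ^ (d : ℝ) * (n : ℝ) ^ c := Real.rpow_add hn0 _ _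
  rw [e1, e2, e3]
  ring

end Asymptotics

end GFF

theorem theorem1p3 (d : ℕ) (hd : 3 ≤ d) (δ : ℝ) (hδ0 : 0 < δ) (hδ1 : δ < 1) (α : ℝ)
    (hα : 3 / 4 * ((d : ℝ) - 2 / 3) / ((d : ℝ) - 1) < α)
    {Ω : ℕ → Type*} [∀ n, MeasurableSpace (Ω n)] (P : ∀ n, Measure (Ω n))
    [∀ n, IsProbabilityMeasure (P n)] (φ : ∀ n, GFF.box d n → Ω n → ℝ)
    (hφ : ∀ n, GFF.IsDGFF d n (φ n) (P n)) :
    Tendsto (fun n : ℕ => GFF.tvDist ((P n).map (GFF.highPoints δ α (φ n)))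
      (GFF.bernoulliSetLaw (GFF.highProb δ α (φ n) (P n)))) atTop (𝓝 0) := by
  have hd3 : (3 : ℝ) ≤ d := by exact_mod_cast hd
  have hα34 := GFF.three_quarters_lt hd hα
  have hα0 : 0 < α := by linarith
  have hG1 := GFF.one_le_greenZero hd
  have hinv : 0 < 1 / (2 * (d : ℝ)) := by positivity
  have hpG : 0 < GFF.greenZero d + GFF.pairGreen d := by rw [GFF.pairGreen]; linarith
  have h2 := GFF.add_two_lt hd hα
  obtain ⟨η, hη0, hη, hηα⟩ : ∃ η : ℝ, 0 < η ∧ η ≤ 1 / 2 ∧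
      (d : ℝ) + 2 + -(α * d * (2 - 4 * η)) < 0 := by
    have hαd : 0 < α * d := by positivity
    -- half of the margin in `d + 2 < 2 * α * d`
    refine ⟨min (1 / 2) ((2 * α * d - (d + 2)) / (8 * (α * d))),
      lt_min (by norm_num) (div_pos (by linarith) (by linarith)), min_le_left _ _, ?_⟩
    have h := min_le_right (1 / 2) ((2 * α * d - (d + 2)) / (8 * (α * d)))
    rw [le_div_iff₀ (by linarith)] at h
    nlinarith
  obtain ⟨C, hC⟩ := GFF.exists_card_le_of_latticeGreen_ge hd hη0
  -- for `n = 0` the bulk may contain boundary points, where the field has no variance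
  refine squeeze_zero' (Eventually.of_forall fun n => Real.iSup_nonneg fun A => abs_nonneg _) ?_
    (GFF.tendsto_bound hd hα0 C (a := -(4 * α * d)) (b := -(α * d * (2 - 4 * η)))
      (c := -(2 * α * d * GFF.greenZero d / (GFF.greenZero d + GFF.pairGreen d))) ?_ hηα ?_)
  · filter_upwards [eventually_ge_atTop 1] with n hn
    exact (GFF.tvDist_le (hφ n) δ α).trans
      ((hφ n).sum_pairCov_le hd hα0 hn hη hC hδ0)
  · nlinarith
  · have h3 := GFF.greenZero_add_pairGreen_lt hd hα
    have : (d : ℝ) < 2 * α * d * GFF.greenZero d / (GFF.greenZero d + GFF.pairGreen d) := by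
      rw [lt_div_iff₀ hpG]
      nlinarith
    linarith
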